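/- **Soundness of cyclic progressing proofs.** *Language.* Number terms are built from number variables, $0$, successor $\mathsf s$, $+$ and $\times$. Pre-formulas are built from $s<t$, $s\nless t$, $s=t$, $s\neq t$, $t\in S$, $t\notin X$ by $\wedge,\vee,\forall x,\exists x$, where a set term $S$ is a set variable $X$ or $\mu Xx\,\varphi$ or $\nu Xx\,\varphi$ (both bind $X$ and $x$ in $\varphi$). Negation $\neg\varphi$ is defined by De Morgan duality, with $\neg(t\in\mu Xx\,\varphi(X)):=t\in\nu Xx\,\neg\varphi(\neg X)$ and dually. A formula is a pre-formula such that, for each of its subexpressions $\mu Xx\,\psi$ or $\nu Xx\,\psi$, no $t\notin X$ occurs in $\psi$ for this bound $X$. Below, all set variables of formulas are bound; number variables may be free. A sequent is a finite list of such formulas. In the standard model $\mathbb N$, the term $\mu Xx\,\varphi$ (resp. $\nu Xx\,\varphi$) denotes the least (resp. greatest) fixed point of $A\mapsto\{a\in\mathbb N\mid \mathbb N,\rho[x\mapsto a,X\mapsto A]\models\varphi\}$, and everything else is interpreted as usual; $\mathbb N\models\Gamma$ means that under every assignment some formula of $\Gamma$ is satisfied. *Rules* (premises / conclusion): $\mathsf{id}$: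 $/\ \Gamma,\neg\varphi,\varphi$; weakening: $\Gamma\ /\ \Gamma,\Delta$; exchange: $\Gamma,\psi,\varphi,\Delta\ /\ \Gamma,\varphi,\psi,\Delta$; substitution: $\Gamma\ /\ \theta(\Gamma)$ for a map $\theta$ from number variables to number terms; cut: $\Gamma,\varphi$ and $\Gamma,\neg\varphi\ /\ \Gamma$; $\wedge$: $\Gamma,\varphi$ and $\Gamma,\psi\ /\ \Gamma,\varphi\wedge\psi$; $\vee$: $\Gamma,\varphi,\psi\ /\ \Gamma,\varphi\vee\psi$; $\forall$: $\Gamma,\varphi[y/x]\ /\ \Gamma,\forall x\varphi$ with $y$ not free in the conclusion; $\exists$: $\Gamma,\varphi[t/x]\ /\ \Gamma,\exists x\varphi$; equality substitution: $\Gamma(s)\ /\ \Gamma(t),s\neq t$; $/\ t=t$; $/\ t\in\mathbf N$ for $\mathbf N:=\mu Xx\,(x=0\vee\exists y(y\in X\wedge x=\mathsf s y))$; the axioms $0\neq\mathsf sx$, $\ \mathsf sx=\mathsf sy\to x=y$, $\ x+0=x$, $\ x+\mathsf sy=\mathsf s(x+y)$, $\ x\times0=0$, $\ x\times\mathsf sy=(x\times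 y)+x$, $\ x<y\leftrightarrow\exists z\,(x+\mathsf sz=y)$; and, for $\sigma\in\{\mu,\nu\}$, the unfolding rule $\sigma$: $\Gamma,\varphi[\sigma Xx\,\varphi/X,t/x]\ /\ \Gamma,t\in\sigma Xx\,\varphi$. The lists $\Gamma,\Delta$, and their substitution instances, are the side formulas; except for exchange, the other formulas of the conclusion are principal and those of the premises are active. *Proofs.* A coderivation is a possibly infinite binary tree whose nodes are labelled by rule instances, such that the successors of each node are labelled by rule instances whose conclusions are exactly the premises at that node. It is cyclic if it has only finitely many distinct sub-coderivations. A trace along an infinite branch is a sequence $(\varphi_i)_{i\ge k}$ of formula occurrences, $\varphi_i$ in the conclusion at the $i$-th node, such that for all $i$: $\varphi_i,\varphi_{i+1}$ are the same side formula (up to the substitution made by the rule), or $\varphi_i$ is principal and $\varphi_{i+1}$ active in a rule other than exchange, or they are the same exchanged formula of an exchange. A set term $\sigma Xx\,\varphi$ progresses at $i$ if $\varphi_i$ is the principal formula $t\in\sigma Xx\,\varphi$ of an instance of the rule $\sigma$, $\sigma\in\{\mu,\nu\}$. A trace is progressing if some $\nu$-term progresses infinitely often and is minimal, with respect to the number of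 symbols not counting those inside number terms, among all set terms that progress infinitely often. A coderivation is a progressing proof if each of its infinite branches has a progressing trace. **Claim.** If $\mathcal D$ is a cyclic progressing proof with conclusion $\Gamma$, then $\mathbb N\models\Gamma$. -/

import Mathlib

/-! Syntax and standard semantics of arithmetic with least and greatest fixed points, and the
cyclic progressing proofs of its one-sided sequent calculus.

Number variables and set variables are two separate families indexed by `ℕ`. Bound variables are
de Bruijn indices, so that formulas are identified up to renaming of bound variables: under `d`
number binders the index `d + i` denotes the free number variable with name `i`, and likewise for
set variables. -/

namespace MuPA

/-- `push a f` is the family `a, f 0, f 1, …`. -/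
def push {α : Type*} (a : α) (f : ℕ → α) : ℕ → α
  | 0 => a
  | i + 1 => f i

/-! ### Terms, pre-formulas, set terms -/

/-- Number terms. -/
inductive Term : Type
  | var (i : ℕ)
  | zero
  | succ (t : Term)
  | add (s t : Term)
  | mul (s t : Term)

/-- Parallel substitution of number terms for number variables. -/
def Term.subst (σ : ℕ → Term) : Term → Term
  | .var i => σ i
  | .zero => .zero
  | .succ t => .succ (t.subst σ)
  | .add s t => .add (s.subst σ) (t.subst σ)
  | .mul s t => .mul (s.subst σ) (t.subst σ)

/-- Renaming of the variables needed when a term is moved under a number binder. -/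
def Term.shift (t : Term) : Term := t.subst fun i => .var (i + 1)

/-- The variable `y` occurs in the term. -/
def Term.Occurs (y : ℕ) : Term → Prop
  | .var i => i = y
  | .zero => False
  | .succ t => t.Occurs y
  | .add s t => s.Occurs y ∨ t.Occurs y
  | .mul s t => s.Occurs y ∨ t.Occurs y

/-- Pre-formulas. `mem t i` and `nmem t i` are `t ∈ X` and `t ∉ X` for the set variable `X` with
index `i`; `memMu t φ` and `memNu t φ` are `t ∈ μ X x φ` and `t ∈ ν X x φ`, where in `φ` the set
variable `0` is `X` and the number variable `0` is `x`. A negated membership `t ∉ S` in a fixed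
point `S` is not primitive but the pre-formula `¬ t ∈ S` given by `PreForm.neg`. -/
inductive PreForm : Type
  | lt (s t : Term)
  | nlt (s t : Term)
  | eq (s t : Term)
  | ne (s t : Term)
  | mem (t : Term) (i : ℕ)
  | nmem (t : Term) (i : ℕ)
  | and (φ ψ : PreForm)
  | or (φ ψ : PreForm)
  | all (φ : PreForm)
  | ex (φ : PreForm)
  | memMu (t : Term) (φ : PreForm)
  | memNu (t : Term) (φ : PreForm)

/-- (Pre-)set-terms: set variables, `μ X x φ` and `ν X x φ`. -/
inductive SetTerm : Type
  | var (i : ℕ)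
  | mu (φ : PreForm)
  | nu (φ : PreForm)

/-- The pre-formula `t ∈ S`. -/
def SetTerm.memOf (t : Term) : SetTerm → PreForm
  | .var i => .mem t i
  | .mu φ => .memMu t φ
  | .nu φ => .memNu t φ

/-- A substitution for number variables, adapted to the scope of one more number binder. -/
def liftSubst (σ : ℕ → Term) : ℕ → Term := push (.var 0) fun i => (σ i).shift

/-- Capture-avoiding parallel substitution of number terms for the free number variables. -/
def PreForm.subst : (ℕ → Term) → PreForm → PreForm
  | σ, .lt s t => .lt (s.subst σ) (t.subst σ)
  | σ, .nlt s t => .nlt (s.subst σ) (t.subst σ)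
  | σ, .eq s t => .eq (s.subst σ) (t.subst σ)
  | σ, .ne s t => .ne (s.subst σ) (t.subst σ)
  | σ, .mem t i => .mem (t.subst σ) i
  | σ, .nmem t i => .nmem (t.subst σ) i
  | σ, .and φ ψ => .and (φ.subst σ) (ψ.subst σ)
  | σ, .or φ ψ => .or (φ.subst σ) (ψ.subst σ)
  | σ, .all φ => .all (φ.subst (liftSubst σ))
  | σ, .ex φ => .ex (φ.subst (liftSubst σ))
  | σ, .memMu t φ => .memMu (t.subst σ) (φ.subst (liftSubst σ))
  | σ, .memNu t φ => .memNu (t.subst σ) (φ.subst (liftSubst σ))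

/-- `φ[t/x]`, where `x` is the number variable `0` of the scope of a removed number binder. -/
def PreForm.inst (t : Term) (φ : PreForm) : PreForm := φ.subst (push t .var)

/-- Negation, pushed to the atoms. The parameter `b` counts the fixed point binders already passed:
since `¬ (t ∈ μ X x φ(X))` is `t ∈ ν X x ¬φ(¬X)`, literals in the variables bound by these binders
are negated twice, hence unchanged. -/
def PreForm.negAux : ℕ → PreForm → PreForm
  | _, .lt s t => .nlt s t
  | _, .nlt s t => .lt s t
  | _, .eq s t => .ne s t
  | _, .ne s t => .eq s t
  | b, .mem t i => if i < b then .mem t i else .nmem t i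
  | b, .nmem t i => if i < b then .nmem t i else .mem t i
  | b, .and φ ψ => .or (φ.negAux b) (ψ.negAux b)
  | b, .or φ ψ => .and (φ.negAux b) (ψ.negAux b)
  | b, .all φ => .ex (φ.negAux b)
  | b, .ex φ => .all (φ.negAux b)
  | b, .memMu t φ => .memNu t (φ.negAux (b + 1))
  | b, .memNu t φ => .memMu t (φ.negAux (b + 1))

/-- The negation `¬ φ`. -/
def PreForm.neg (φ : PreForm) : PreForm := φ.negAux 0

/-- `φ → ψ` is `¬ φ ∨ ψ`. -/
def PreForm.imp (φ ψ : PreForm) : PreForm := .or φ.neg ψ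

/-- `φ ↔ ψ` is `(φ → ψ) ∧ (ψ → φ)`. -/
def PreForm.iff (φ ψ : PreForm) : PreForm := .and (φ.imp ψ) (ψ.imp φ)

/-- Renaming of the free set variables. -/
def PreForm.setRename : (ℕ → ℕ) → PreForm → PreForm
  | _, .lt s t => .lt s t
  | _, .nlt s t => .nlt s t
  | _, .eq s t => .eq s t
  | _, .ne s t => .ne s t
  | f, .mem t i => .mem t (f i)
  | f, .nmem t i => .nmem t (f i)
  | f, .and φ ψ => .and (φ.setRename f) (ψ.setRename f)
  | f, .or φ ψ => .or (φ.setRename f) (ψ.setRename f)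
  | f, .all φ => .all (φ.setRename f)
  | f, .ex φ => .ex (φ.setRename f)
  | f, .memMu t φ => .memMu t (φ.setRename (push 0 fun i => f i + 1))
  | f, .memNu t φ => .memNu t (φ.setRename (push 0 fun i => f i + 1))

/-- A set term moved under a number binder. -/
def SetTerm.numShift : SetTerm → SetTerm
  | .var i => .var i
  | .mu φ => .mu (φ.subst (liftSubst fun i => .var (i + 1)))
  | .nu φ => .nu (φ.subst (liftSubst fun i => .var (i + 1)))

/-- A set term moved under a set binder. -/
def SetTerm.setShift : SetTerm → SetTerm
  | .var i => .var (i + 1)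
  | .mu φ => .mu (φ.setRename (push 0 fun i => i + 1 + 1))
  | .nu φ => .nu (φ.setRename (push 0 fun i => i + 1 + 1))

/-- Capture-avoiding parallel substitution of set terms for the free set variables. -/
def PreForm.setSubst : (ℕ → SetTerm) → PreForm → PreForm
  | _, .lt s t => .lt s t
  | _, .nlt s t => .nlt s t
  | _, .eq s t => .eq s t
  | _, .ne s t => .ne s t
  | τ, .mem t i => (τ i).memOf t
  | τ, .nmem t i => ((τ i).memOf t).neg
  | τ, .and φ ψ => .and (φ.setSubst τ) (ψ.setSubst τ)
  | τ, .or φ ψ => .or (φ.setSubst τ) (ψ.setSubst τ)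
  | τ, .all φ => .all (φ.setSubst fun i => (τ i).numShift)
  | τ, .ex φ => .ex (φ.setSubst fun i => (τ i).numShift)
  | τ, .memMu t φ =>
      .memMu t (φ.setSubst (push (.var 0) fun i => (τ i).numShift.setShift))
  | τ, .memNu t φ =>
      .memNu t (φ.setSubst (push (.var 0) fun i => (τ i).numShift.setShift))

/-- `φ[S/X, t/x]` for the body `φ` of a fixed point `μ X x φ` or `ν X x φ`. -/
def PreForm.unfold (S : SetTerm) (t : Term) (φ : PreForm) : PreForm :=
  (φ.inst t).setSubst (push S .var)

/-- The number variable `y` occurs free in the pre-formula. -/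
def PreForm.Occurs : ℕ → PreForm → Prop
  | y, .lt s t => s.Occurs y ∨ t.Occurs y
  | y, .nlt s t => s.Occurs y ∨ t.Occurs y
  | y, .eq s t => s.Occurs y ∨ t.Occurs y
  | y, .ne s t => s.Occurs y ∨ t.Occurs y
  | y, .mem t _ => t.Occurs y
  | y, .nmem t _ => t.Occurs y
  | y, .and φ ψ => φ.Occurs y ∨ ψ.Occurs y
  | y, .or φ ψ => φ.Occurs y ∨ ψ.Occurs y
  | y, .all φ => φ.Occurs (y + 1)
  | y, .ex φ => φ.Occurs (y + 1)
  | y, .memMu t φ => t.Occurs y ∨ φ.Occurs (y + 1)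
  | y, .memNu t φ => t.Occurs y ∨ φ.Occurs (y + 1)

/-- The free set variable with index `X` occurs positively: there is no `t ∉ X`. -/
def PreForm.PositiveIn : ℕ → PreForm → Prop
  | _, .lt _ _ => True
  | _, .nlt _ _ => True
  | _, .eq _ _ => True
  | _, .ne _ _ => True
  | _, .mem _ _ => True
  | X, .nmem _ i => i ≠ X
  | X, .and φ ψ => φ.PositiveIn X ∧ ψ.PositiveIn X
  | X, .or φ ψ => φ.PositiveIn X ∧ ψ.PositiveIn X
  | X, .all φ => φ.PositiveIn X
  | X, .ex φ => φ.PositiveIn X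
  | X, .memMu _ φ => φ.PositiveIn (X + 1)
  | X, .memNu _ φ => φ.PositiveIn (X + 1)

/-- Formulas: pre-formulas in which every fixed point binder binds a variable that occurs
positively in its body. -/
def PreForm.IsFormula : PreForm → Prop
  | .and φ ψ => φ.IsFormula ∧ ψ.IsFormula
  | .or φ ψ => φ.IsFormula ∧ ψ.IsFormula
  | .all φ => φ.IsFormula
  | .ex φ => φ.IsFormula
  | .memMu _ φ => φ.PositiveIn 0 ∧ φ.IsFormula
  | .memNu _ φ => φ.PositiveIn 0 ∧ φ.IsFormula
  | _ => True

/-- All free set variables have an index below `d`. -/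
def PreForm.SetVarsBelow : ℕ → PreForm → Prop
  | d, .mem _ i => i < d
  | d, .nmem _ i => i < d
  | d, .and φ ψ => φ.SetVarsBelow d ∧ ψ.SetVarsBelow d
  | d, .or φ ψ => φ.SetVarsBelow d ∧ ψ.SetVarsBelow d
  | d, .all φ => φ.SetVarsBelow d
  | d, .ex φ => φ.SetVarsBelow d
  | d, .memMu _ φ => φ.SetVarsBelow (d + 1)
  | d, .memNu _ φ => φ.SetVarsBelow (d + 1)
  | _, _ => True

/-- Sequents are lists; the proof system only uses sequents that satisfy `IsSequent`. -/
abbrev Sequent := List PreForm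

/-- Every member is a formula in which every set variable is bound. -/
def IsSequent (Γ : Sequent) : Prop := ∀ φ ∈ Γ, φ.IsFormula ∧ φ.SetVarsBelow 0

/-- Number of symbols of a pre-formula, where the symbols inside number terms are not counted, so
that substitutions of number terms do not change it. -/
def PreForm.size : PreForm → ℕ
  | .lt _ _ => 1
  | .nlt _ _ => 1
  | .eq _ _ => 1
  | .ne _ _ => 1
  | .mem _ _ => 2
  | .nmem _ _ => 2
  | .and φ ψ => φ.size + ψ.size + 1
  | .or φ ψ => φ.size + ψ.size + 1
  | .all φ => φ.size + 2
  | .ex φ => φ.size + 2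
  | .memMu _ φ => φ.size + 4
  | .memNu _ φ => φ.size + 4

/-- Number of symbols of a set term, where the symbols inside number terms are not counted. -/
def SetTerm.size : SetTerm → ℕ
  | .var _ => 1
  | .mu φ => φ.size + 3
  | .nu φ => φ.size + 3

/-! ### The standard model -/

/-- Value of a number term in the standard model. -/
def Term.eval (ρ : ℕ → ℕ) : Term → ℕ
  | .var i => ρ i
  | .zero => 0
  | .succ t => t.eval ρ + 1
  | .add s t => s.eval ρ + t.eval ρ
  | .mul s t => s.eval ρ * t.eval ρ

/-- The least fixed point of a monotone operator on sets, as in the Knaster–Tarski theorem. -/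
def leastFix (f : Set ℕ → Set ℕ) : Set ℕ := ⋂₀ {A | f A ⊆ A}

/-- The greatest fixed point of a monotone operator on sets, as in the Knaster–Tarski theorem. -/
def greatestFix (f : Set ℕ → Set ℕ) : Set ℕ := ⋃₀ {A | A ⊆ f A}

theorem isLeast_leastFix {f : Set ℕ → Set ℕ} (hf : Monotone f) :
    IsLeast {A | f A = A} (leastFix f) :=
  OrderHom.isLeast_lfp ⟨f, hf⟩

theorem isGreatest_greatestFix {f : Set ℕ → Set ℕ} (hf : Monotone f) :
    IsGreatest {A | f A = A} (greatestFix f) :=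
  OrderHom.isGreatest_gfp ⟨f, hf⟩

/-- Satisfaction in the standard model, where `ρ` assigns numbers to the number variables and `V`
assigns sets of numbers to the set variables. -/
def PreForm.Sat : PreForm → (ℕ → ℕ) → (ℕ → Set ℕ) → Prop
  | .lt s t, ρ, _ => s.eval ρ < t.eval ρ
  | .nlt s t, ρ, _ => ¬ s.eval ρ < t.eval ρ
  | .eq s t, ρ, _ => s.eval ρ = t.eval ρ
  | .ne s t, ρ, _ => s.eval ρ ≠ t.eval ρ
  | .mem t i, ρ, V => t.eval ρ ∈ V i
  | .nmem t i, ρ, V => t.eval ρ ∉ V i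
  | .and φ ψ, ρ, V => φ.Sat ρ V ∧ ψ.Sat ρ V
  | .or φ ψ, ρ, V => φ.Sat ρ V ∨ ψ.Sat ρ V
  | .all φ, ρ, V => ∀ a : ℕ, φ.Sat (push a ρ) V
  | .ex φ, ρ, V => ∃ a : ℕ, φ.Sat (push a ρ) V
  | .memMu t φ, ρ, V => t.eval ρ ∈ leastFix fun A => {a | φ.Sat (push a ρ) (push A V)}
  | .memNu t φ, ρ, V => t.eval ρ ∈ greatestFix fun A => {a | φ.Sat (push a ρ) (push A V)}

/-- `ℕ ⊨ Γ`: under every assignment, the disjunction of the sequent is satisfied. -/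
def TrueInStandardModel (Γ : Sequent) : Prop :=
  ∀ (ρ : ℕ → ℕ) (V : ℕ → Set ℕ), ∃ φ ∈ Γ, φ.Sat ρ V

/-! ### Rules -/

/-- The set term `𝐍 = μ X x (x = 0 ∨ ∃ y (y ∈ X ∧ x = S y))`. -/
def natSet : SetTerm :=
  .mu (.or (.eq (.var 0) .zero)
    (.ex (.and (.mem (.var 0) 0) (.eq (.var 1) (.succ (.var 0))))))

/-- The axioms `PA₁, …, PA₇`, with the number variables named `x` and `y`. -/
def paAxiom (x y : ℕ) : Fin 7 → PreForm
  | 0 => .ne .zero (.succ (.var x))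
  | 1 => .imp (.eq (.succ (.var x)) (.succ (.var y))) (.eq (.var x) (.var y))
  | 2 => .eq (.add (.var x) .zero) (.var x)
  | 3 => .eq (.add (.var x) (.succ (.var y))) (.succ (.add (.var x) (.var y)))
  | 4 => .eq (.mul (.var x) .zero) .zero
  | 5 => .eq (.mul (.var x) (.succ (.var y))) (.add (.mul (.var x) (.var y)) (.var x))
  | 6 => .iff (.lt (.var x) (.var y))
      (.ex (.eq (.add (.var (x + 1)) (.succ (.var 0))) (.var (y + 1))))

/-- Instances of the inference rules; `conclusion`, `premises` and `SideCondition` below say what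
each of them is. -/
inductive Rule : Type
  | id (Γ : Sequent) (φ : PreForm)
  | weak (Γ Δ : Sequent)
  | exch (Γ : Sequent) (φ ψ : PreForm) (Δ : Sequent)
  | sub (θ : ℕ → Term) (Γ : Sequent)
  | cut (Γ : Sequent) (φ : PreForm)
  | and (Γ : Sequent) (φ ψ : PreForm)
  | or (Γ : Sequent) (φ ψ : PreForm)
  | all (Γ : Sequent) (φ : PreForm) (y : ℕ)
  | ex (Γ : Sequent) (φ : PreForm) (t : Term)
  | eqSub (Γ : Sequent) (s t : Term)
  | refl (t : Term)
  | pa (i : Fin 7) (x y : ℕ)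
  | nat (t : Term)
  | mu (Γ : Sequent) (t : Term) (φ : PreForm)
  | nu (Γ : Sequent) (t : Term) (φ : PreForm)

/-- In `eqSub`, the hole of the context `Γ(·)` is the number variable `0` of `Γ`. -/
def Rule.conclusion : Rule → Sequent
  | .id Γ φ => Γ ++ [φ.neg, φ]
  | .weak Γ Δ => Γ ++ Δ
  | .exch Γ φ ψ Δ => Γ ++ φ :: ψ :: Δ
  | .sub θ Γ => Γ.map (PreForm.subst θ)
  | .cut Γ _ => Γ
  | .and Γ φ ψ => Γ ++ [.and φ ψ]
  | .or Γ φ ψ => Γ ++ [.or φ ψ]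
  | .all Γ φ _ => Γ ++ [.all φ]
  | .ex Γ φ _ => Γ ++ [.ex φ]
  | .eqSub Γ s t => Γ.map (PreForm.inst t) ++ [.ne s t]
  | .refl t => [.eq t t]
  | .pa i x y => [paAxiom x y i]
  | .nat t => [natSet.memOf t]
  | .mu Γ t φ => Γ ++ [.memMu t φ]
  | .nu Γ t φ => Γ ++ [.memNu t φ]

/-- The premises, from left to right. -/
def Rule.premises : Rule → List Sequent
  | .id _ _ => []
  | .weak Γ _ => [Γ]
  | .exch Γ φ ψ Δ => [Γ ++ ψ :: φ :: Δ]
  | .sub _ Γ => [Γ]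
  | .cut Γ φ => [Γ ++ [φ], Γ ++ [φ.neg]]
  | .and Γ φ ψ => [Γ ++ [φ], Γ ++ [ψ]]
  | .or Γ φ ψ => [Γ ++ [φ, ψ]]
  | .all Γ φ y => [Γ ++ [φ.inst (.var y)]]
  | .ex Γ φ t => [Γ ++ [φ.inst t]]
  | .eqSub Γ s _ => [Γ.map (PreForm.inst s)]
  | .refl _ => []
  | .pa _ _ _ => []
  | .nat _ => []
  | .mu Γ t φ => [Γ ++ [φ.unfold (.mu φ) t]]
  | .nu Γ t φ => [Γ ++ [φ.unfold (.nu φ) t]]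

/-- The variable of the rule for `∀` is fresh: it does not occur in the conclusion. -/
def Rule.SideCondition : Rule → Prop
  | .all Γ φ y => ∀ ψ ∈ Γ ++ [.all φ], ¬ ψ.Occurs y
  | _ => True

/-- The formula at position `q` of a premise is an immediate ancestor of the formula at position
`p` of the conclusion: both are the same side formula, or (for the rules other than exchange) `p`
is the position of the principal formula and `q` of an active formula, or they are the same
exchanged formula in an exchange. Positions count from `0`; in a rule with two premises the
positions are the same for both. -/
def Rule.Ancestor : Rule → ℕ → ℕ → Prop
  | .weak Γ _, p, q => p < Γ.length ∧ q = p
  | .exch Γ _ _ Δ, p, q =>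
      (p < Γ.length ∧ q = p) ∨
      (p = Γ.length ∧ q = Γ.length + 1) ∨
      (p = Γ.length + 1 ∧ q = Γ.length) ∨
      (Γ.length + 2 ≤ p ∧ p < Γ.length + 2 + Δ.length ∧ q = p)
  | .sub _ Γ, p, q => p < Γ.length ∧ q = p
  | .cut Γ _, p, q => p < Γ.length ∧ q = p
  | .and Γ _ _, p, q => (p < Γ.length ∧ q = p) ∨ (p = Γ.length ∧ q = Γ.length)
  | .or Γ _ _, p, q =>
      (p < Γ.length ∧ q = p) ∨ (p = Γ.length ∧ (q = Γ.length ∨ q = Γ.length + 1))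
  | .all Γ _ _, p, q => (p < Γ.length ∧ q = p) ∨ (p = Γ.length ∧ q = Γ.length)
  | .ex Γ _ _, p, q => (p < Γ.length ∧ q = p) ∨ (p = Γ.length ∧ q = Γ.length)
  | .eqSub Γ _ _, p, q => p < Γ.length ∧ q = p
  | .mu Γ _ _, p, q => (p < Γ.length ∧ q = p) ∨ (p = Γ.length ∧ q = Γ.length)
  | .nu Γ _ _, p, q => (p < Γ.length ∧ q = p) ∨ (p = Γ.length ∧ q = Γ.length)
  | _, _, _ => False

/-- The set term `S` is unfolded by the rule, and its principal formula is at position `p`. -/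
def Rule.Unfolds : Rule → ℕ → SetTerm → Prop
  | .mu Γ _ φ, p, S => p = Γ.length ∧ S = .mu φ
  | .nu Γ _ φ, p, S => p = Γ.length ∧ S = .nu φ
  | _, _, _ => False

/-! ### Coderivations and cyclic progressing proofs -/

/-- Coderivations: non-empty prefix-closed binary trees labelled with rule instances. A tree with
its labelling is a partial function on binary strings, with the support as its domain. The
successor `v ++ [false]` carries the first premise of the rule at `v`, and `v ++ [true]` the
second one. -/
structure Coderivation where
  label : List Bool → Option Rule
  root : label [] ≠ none
  prefix_closed : ∀ v b, label v = none → label (v ++ [b]) = none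
  sequents : ∀ v r, label v = some r →
    IsSequent r.conclusion ∧ (∀ Γ ∈ r.premises, IsSequent Γ) ∧ r.SideCondition
  successors : ∀ v r, label v = some r →
    ∀ b : Bool, (label (v ++ [b])).map Rule.conclusion = r.premises[b.toNat]?

namespace Coderivation

/-- The conclusion of the rule at the root is `Γ`. -/
def HasConclusion (D : Coderivation) (Γ : Sequent) : Prop :=
  (D.label []).map Rule.conclusion = some Γ

/-- There are only finitely many sub-coderivations. -/
def IsCyclic (D : Coderivation) : Prop :=
  {f : List Bool → Option Rule |
    ∃ u, D.label u ≠ none ∧ f = fun v => D.label (u ++ v)}.Finite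

/-- `v` is an infinite branch. -/
def IsBranch (D : Coderivation) (v : ℕ → List Bool) : Prop :=
  v 0 = [] ∧ (∀ i, ∃ b, v (i + 1) = v i ++ [b]) ∧ ∀ i, D.label (v i) ≠ none

/-- The formula occurrences at the positions `p i`, `i ≥ k`, form a trace along `v`. -/
def IsTrace (D : Coderivation) (v : ℕ → List Bool) (k : ℕ) (p : ℕ → ℕ) : Prop :=
  ∀ i ≥ k, ∃ r, D.label (v i) = some r ∧ r.Ancestor (p i) (p (i + 1))

/-- The set term `S` progresses infinitely often along the trace. -/
def ProgressesInfinitelyOften (D : Coderivation) (v : ℕ → List Bool) (p : ℕ → ℕ)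
    (S : SetTerm) : Prop :=
  ∀ m, ∃ i ≥ m, ∃ r, D.label (v i) = some r ∧ r.Unfolds (p i) S

/-- A trace is progressing if some `ν`-term progresses infinitely often and has minimal size among
all set terms that do. -/
def IsProgressingTrace (D : Coderivation) (v : ℕ → List Bool) (k : ℕ) (p : ℕ → ℕ) : Prop :=
  D.IsTrace v k p ∧ ∃ φ : PreForm, D.ProgressesInfinitelyOften v p (.nu φ) ∧
    ∀ S, D.ProgressesInfinitelyOften v p S → (SetTerm.nu φ).size ≤ S.size

/-- Every infinite branch has a progressing trace. -/
def IsProgressing (D : Coderivation) : Prop :=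
  ∀ v, D.IsBranch v → ∃ k p, D.IsProgressingTrace v k p

end Coderivation

end MuPA

namespace MuPA

/-! ### Transfinite approximation of greatest fixed points -/

/-! Suppose some assignment falsifies the conclusion. Every rule is locally sound, so falsity
propagates upwards along an infinite branch, and a progressing trace on that branch is refuted by an
ordinal descent.

The ordinals come from approximating every closed `ν`-term from above, at a stage that depends only
on the size of the term (`SatStage`). At the common stationary stage `closureOrd` this is ordinary
satisfaction (`sat_iff_satStage`). A signature of a falsified formula is a family of stages, one
coordinate per size, that falsifies it and is lexicographically least, small sizes being the most
significant. One signature is fixed for each formula and assignment, so the branch can be built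
before any trace is known: the premise for a conjunction and the witness for a universal quantifier
are read off the signature of the principal formula (`Rule.exists_falsified_premise`).

Unfolding a set term of size n closes only those open `ν`-terms that swallow it, and these are
larger (`satStage_setSubst`). Hence coordinates above n can be reset to `closureOrd`, a
`μ`-unfolding preserves the coordinates up to n, and a `ν`-unfolding lowers coordinate n while
preserving the smaller ones (`not_satStage_unfold_mu`, `not_satStage_unfold_nu`).

Now let n be the size of the minimal `ν`-term that progresses infinitely often. A cyclic
coderivation has finitely many rule instances, so from some point on the trace unfolds only terms of
size at least n. From there the first n + 1 coordinates never increase lexicographically, and they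
decrease strictly infinitely often, which is impossible (`not_falsified`). -/

/-- The approximation of the greatest fixed point of `f` from above at stage `α`. -/
noncomputable def nuStage (f : Set ℕ → Set ℕ) (α : Ordinal.{0}) : Set ℕ :=
  ⋂ β : Set.Iio α, f (nuStage f β)
termination_by α
decreasing_by exact β.2

theorem mem_nuStage {f : Set ℕ → Set ℕ} {α : Ordinal.{0}} {a : ℕ} :
    a ∈ nuStage f α ↔ ∀ β < α, a ∈ f (nuStage f β) := by
  rw [nuStage]
  simp

theorem nuStage_antitone (f : Set ℕ → Set ℕ) : Antitone (nuStage f) := fun _ _ h _ ha =>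
  mem_nuStage.2 fun γ hγ => mem_nuStage.1 ha γ (hγ.trans_le h)

theorem nuStage_mono {f g : Set ℕ → Set ℕ} (hg : Monotone g) (h : ∀ A, f A ⊆ g A)
    (α : Ordinal.{0}) : nuStage f α ⊆ nuStage g α := by
  induction α using WellFoundedLT.induction with
  | _ α ih =>
    intro a ha
    exact mem_nuStage.2 fun β hβ => hg (ih β hβ) (h _ (mem_nuStage.1 ha β hβ))

theorem greatestFix_subset_nuStage {f : Set ℕ → Set ℕ} (hf : Monotone f) (α : Ordinal.{0}) :
    greatestFix f ⊆ nuStage f α := by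
  induction α using WellFoundedLT.induction with
  | _ α ih =>
    intro a ha
    refine mem_nuStage.2 fun β hβ => hf (ih β hβ) ?_
    have h : f (greatestFix f) = greatestFix f := (isGreatest_greatestFix hf).1
    rwa [h]

/-- The ordinals do not inject into the sets of numbers, so two stages α < β coincide. Stage β lies
inside the image under `f` of stage α, which makes stage α a post-fixed point. -/
theorem exists_nuStage_eq {f : Set ℕ → Set ℕ} (hf : Monotone f) :
    ∃ α : Ordinal.{0}, nuStage f α = greatestFix f := by
  have h := not_injective_of_ordinal (nuStage f)
  simp only [Function.Injective, not_forall] at h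
  obtain ⟨α, β, hαβ, hne⟩ := h
  wlog hlt : α < β generalizing α β
  · exact this β α hαβ.symm (Ne.symm hne) (lt_of_le_of_ne (not_lt.1 hlt) (Ne.symm hne))
  refine ⟨α, subset_antisymm ?_ (greatestFix_subset_nuStage hf α)⟩
  refine Set.subset_sUnion_of_mem (t := nuStage f α) (S := {A | A ⊆ f A}) ?_
  intro a ha
  rw [hαβ] at ha
  exact mem_nuStage.1 ha α hlt

/-- The operators on sets of numbers form a small type, so their closure ordinals have a supremum in
the same universe. Beyond its closure ordinal an operator's stages are squeezed between that stage
and the greatest fixed point. -/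
theorem exists_closure_ordinal :
    ∃ Ω : Ordinal.{0}, ∀ f, Monotone f → nuStage f Ω = greatestFix f := by
  choose g hg using fun f : {f : Set ℕ → Set ℕ // Monotone f} => exists_nuStage_eq f.2
  refine ⟨⨆ f, g f, fun f hf => subset_antisymm ?_ (greatestFix_subset_nuStage hf _)⟩
  rw [← hg ⟨f, hf⟩]
  exact nuStage_antitone f (Ordinal.le_iSup g _)

/-- A stage at which the approximations of all monotone operators have become stationary. -/
noncomputable def closureOrd : Ordinal.{0} := exists_closure_ordinal.choose

theorem nuStage_closureOrd {f : Set ℕ → Set ℕ} (hf : Monotone f) :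
    nuStage f closureOrd = greatestFix f :=
  exists_closure_ordinal.choose_spec f hf

theorem leastFix_mono {f g : Set ℕ → Set ℕ} (h : ∀ A, f A ⊆ g A) : leastFix f ⊆ leastFix g :=
  Set.sInter_subset_sInter fun A hA => (h A).trans hA

/-- Complementation exchanges pre-fixed points of `f` with post-fixed points of its dual. This is
the semantic content of the De Morgan law for fixed points. -/
theorem greatestFix_compl (f : Set ℕ → Set ℕ) :
    greatestFix (fun A => (f Aᶜ)ᶜ) = (leastFix f)ᶜ := by
  ext a
  simp only [greatestFix, leastFix, Set.mem_sUnion, Set.mem_ofPred_eq, Set.mem_compl_iff,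
    Set.mem_sInter, not_forall, exists_prop]
  constructor
  · rintro ⟨A, hA, ha⟩
    exact ⟨Aᶜ, Set.subset_compl_comm.1 hA, fun h => h ha⟩
  · rintro ⟨A, hA, ha⟩
    refine ⟨Aᶜ, ?_, ha⟩
    rw [compl_compl]
    exact Set.compl_subset_compl.2 hA

theorem leastFix_compl (f : Set ℕ → Set ℕ) :
    leastFix (fun A => (f Aᶜ)ᶜ) = (greatestFix f)ᶜ := by
  have h := greatestFix_compl fun A => (f Aᶜ)ᶜ
  simp only [compl_compl] at h
  rw [h, compl_compl]

/-! ### Syntactic lemmas -/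

theorem push_comp {α β : Type*} (g : α → β) (a : α) (f : ℕ → α) :
    (fun i => g (push a f i)) = push (g a) fun i => g (f i) := by
  funext i
  cases i <;> rfl

@[simp] theorem PreForm.size_subst (φ : PreForm) (σ : ℕ → Term) :
    (φ.subst σ).size = φ.size := by
  induction φ generalizing σ <;> simp_all [PreForm.subst, PreForm.size]

@[simp] theorem PreForm.setVarsBelow_subst (φ : PreForm) (σ : ℕ → Term) (d : ℕ) :
    (φ.subst σ).SetVarsBelow d ↔ φ.SetVarsBelow d := by
  induction φ generalizing σ d <;> simp_all [PreForm.subst, PreForm.SetVarsBelow]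

@[simp] theorem PreForm.size_setRename (φ : PreForm) (f : ℕ → ℕ) :
    (φ.setRename f).size = φ.size := by
  induction φ generalizing f <;> simp_all [PreForm.setRename, PreForm.size]

theorem PreForm.setVarsBelow_setRename (φ : PreForm) (f : ℕ → ℕ) (d : ℕ)
    (hf : ∀ i, f i < d ↔ i < d) : (φ.setRename f).SetVarsBelow d ↔ φ.SetVarsBelow d := by
  have hpush : ∀ (f : ℕ → ℕ) (d : ℕ), (∀ i, f i < d ↔ i < d) →
      ∀ i, push 0 (fun i => f i + 1) i < d + 1 ↔ i < d + 1 := by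
    intro f d hf i
    cases i <;> simp [push, hf]
  induction φ generalizing f d <;>
    simp_all only [PreForm.setRename, PreForm.SetVarsBelow, implies_true]

@[simp] theorem SetTerm.size_numShift (S : SetTerm) : S.numShift.size = S.size := by
  cases S <;> simp [SetTerm.numShift, SetTerm.size]

@[simp] theorem SetTerm.size_setShift (S : SetTerm) : S.setShift.size = S.size := by
  cases S <;> simp [SetTerm.setShift, SetTerm.size]

theorem SetTerm.size_memOf (S : SetTerm) (t : Term) : (S.memOf t).size = S.size + 1 := by
  cases S <;> rfl

theorem PreForm.setSubst_eq_self (φ : PreForm) (d : ℕ) (τ : ℕ → SetTerm)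
    (hφ : φ.SetVarsBelow d) (hτ : ∀ i < d, τ i = .var i) : φ.setSubst τ = φ := by
  have hnum : ∀ (d : ℕ) (τ : ℕ → SetTerm), (∀ i < d, τ i = .var i) →
      ∀ i < d, (τ i).numShift = .var i := by
    intro d τ hτ i hi
    rw [hτ i hi]
    rfl
  have hpush : ∀ (d : ℕ) (τ : ℕ → SetTerm), (∀ i < d, τ i = .var i) →
      ∀ i < d + 1, push (.var 0) (fun i => (τ i).numShift.setShift) i = .var i := by
    intro d τ hτ i hi
    cases i with
    | zero => rfl
    | succ i => simp only [push]; rw [hτ i (by omega)]; rfl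
  induction φ generalizing d τ with
  | lt | nlt | eq | ne => rfl
  | mem t i => simp only [setSubst, hτ i hφ]; rfl
  | nmem t i => simp [setSubst, hτ i hφ, SetTerm.memOf, neg, negAux]
  | and φ ψ ihφ ihψ => simp only [setSubst, ihφ d τ hφ.1 hτ, ihψ d τ hφ.2 hτ]
  | or φ ψ ihφ ihψ => simp only [setSubst, ihφ d τ hφ.1 hτ, ihψ d τ hφ.2 hτ]
  | all φ ih | ex φ ih => simp only [setSubst, ih d _ hφ (hnum d τ hτ)]
  | memMu t φ ih | memNu t φ ih => simp only [setSubst, ih (d + 1) _ hφ (hpush d τ hτ)]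

/-- There is no `t ∉ X` in the pre-formula. -/
def PreForm.NegFree : PreForm → Prop
  | .nmem _ _ => False
  | .and φ ψ => φ.NegFree ∧ ψ.NegFree
  | .or φ ψ => φ.NegFree ∧ ψ.NegFree
  | .all φ => φ.NegFree
  | .ex φ => φ.NegFree
  | .memMu _ φ => φ.NegFree
  | .memNu _ φ => φ.NegFree
  | _ => True

theorem PreForm.NegFree.inst {φ : PreForm} (hφ : φ.NegFree) (t : Term) : (φ.inst t).NegFree := by
  unfold PreForm.inst
  generalize push t Term.var = σ
  induction φ generalizing σ <;> simp_all [PreForm.NegFree, PreForm.subst]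

/-- Once the free variables are positive too, the condition at each binder rules out negative
literals altogether. `NegFree` passes to bodies without counting binders, which is why the semantic
inductions use it. -/
theorem PreForm.IsFormula.negFree {φ : PreForm} (hφ : φ.IsFormula) {d : ℕ}
    (hd : φ.SetVarsBelow d) (hpos : ∀ i < d, φ.PositiveIn i) : φ.NegFree := by
  induction φ generalizing d with
  | lt | nlt | eq | ne | mem => trivial
  | nmem t i => exact hpos i hd rfl
  | and φ ψ ihφ ihψ | or φ ψ ihφ ihψ =>
    exact ⟨ihφ hφ.1 hd.1 fun i hi => (hpos i hi).1, ihψ hφ.2 hd.2 fun i hi => (hpos i hi).2⟩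
  | all φ ih | ex φ ih => exact ih hφ hd hpos
  | memMu t φ ih | memNu t φ ih =>
    refine ih hφ.2 (d := d + 1) hd fun i hi => ?_
    cases i with
    | zero => exact hφ.1
    | succ i => exact hpos i (by omega)

theorem IsSequent.negFree {Γ : Sequent} (hΓ : IsSequent Γ) {φ : PreForm} (hφ : φ ∈ Γ) :
    φ.NegFree :=
  (hΓ φ hφ).1.negFree (hΓ φ hφ).2 fun _ hi => absurd hi (Nat.not_lt_zero _)

/-- If a substitution removes all set variables from `d` on, it has put some set term into the
formula. -/
theorem PreForm.le_size_setSubst {n : ℕ} (φ : PreForm) (hneg : φ.NegFree) (d : ℕ)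
    (τ : ℕ → SetTerm) (hφ : ¬ φ.SetVarsBelow d) (hφτ : (φ.setSubst τ).SetVarsBelow d)
    (hτ : ∀ i, d ≤ i → (∃ j, d ≤ j ∧ τ i = .var j) ∨ n ≤ (τ i).size) :
    n ≤ (φ.setSubst τ).size := by
  have hnum : ∀ (d : ℕ) (τ : ℕ → SetTerm),
      (∀ i, d ≤ i → (∃ j, d ≤ j ∧ τ i = .var j) ∨ n ≤ (τ i).size) →
      ∀ i, d ≤ i → (∃ j, d ≤ j ∧ (τ i).numShift = .var j) ∨ n ≤ (τ i).numShift.size := by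
    intro d τ hτ i hi
    rcases hτ i hi with ⟨j, hj, h⟩ | h
    · exact .inl ⟨j, hj, by rw [h]; rfl⟩
    · exact .inr (by simpa using h)
  have hpush : ∀ (d : ℕ) (τ : ℕ → SetTerm),
      (∀ i, d ≤ i → (∃ j, d ≤ j ∧ τ i = .var j) ∨ n ≤ (τ i).size) →
      ∀ i, d + 1 ≤ i →
        (∃ j, d + 1 ≤ j ∧ push (.var 0) (fun i => (τ i).numShift.setShift) i = .var j) ∨
        n ≤ (push (.var 0) (fun i => (τ i).numShift.setShift) i).size := by
    intro d τ hτ i hi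
    cases i with
    | zero => omega
    | succ i =>
      rcases hτ i (by omega) with ⟨j, hj, h⟩ | h
      · exact .inl ⟨j + 1, by omega, by simp only [push]; rw [h]; rfl⟩
      · exact .inr (by simpa [push] using h)
  induction φ generalizing d τ with
  | lt | nlt | eq | ne => exact absurd trivial hφ
  | nmem => exact hneg.elim
  | mem t i =>
    -- If the variable were merely renamed, it would still be free after the substitution, against
    -- `hφτ`.
    rcases hτ i (not_lt.1 hφ) with ⟨j, hj, h⟩ | h
    · simp only [setSubst, h, SetTerm.memOf, SetVarsBelow] at hφτ
      omega
    · simp only [setSubst, SetTerm.size_memOf]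
      omega
  | and φ ψ ihφ ihψ | or φ ψ ihφ ihψ =>
    simp only [setSubst, size]
    by_cases h : φ.SetVarsBelow d
    · have := ihψ hneg.2 d τ (fun h' => hφ ⟨h, h'⟩) hφτ.2 hτ
      omega
    · have := ihφ hneg.1 d τ h hφτ.1 hτ
      omega
  | all φ ih | ex φ ih =>
    have := ih hneg d _ hφ hφτ (hnum d τ hτ)
    simp only [setSubst, size]
    omega
  | memMu t φ ih | memNu t φ ih =>
    have := ih hneg (d + 1) _ hφ hφτ (hpush d τ hτ)
    simp only [setSubst, size]
    omega

/-! ### Satisfaction with approximated `ν`-terms -/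

theorem Term.eval_subst (t : Term) (σ : ℕ → Term) (ρ : ℕ → ℕ) :
    (t.subst σ).eval ρ = t.eval fun i => (σ i).eval ρ := by
  induction t <;> simp_all [Term.subst, Term.eval]

theorem Term.eval_congr (t : Term) {ρ ρ' : ℕ → ℕ} (h : ∀ y, t.Occurs y → ρ y = ρ' y) :
    t.eval ρ = t.eval ρ' := by
  induction t <;> simp_all [Term.Occurs, Term.eval]

theorem eval_liftSubst (σ : ℕ → Term) (a : ℕ) (ρ : ℕ → ℕ) :
    (fun i => (liftSubst σ i).eval (push a ρ)) = push a fun i => (σ i).eval ρ := by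
  rw [liftSubst, push_comp (Term.eval (push a ρ))]
  congr 1
  funext i
  exact Term.eval_subst _ _ _

open Classical in
/-- The stage at which `ν X x φ` is approximated: it is given by `α` and the size of the set term
if the latter has no free set variables, and stationary otherwise. -/
noncomputable def nuIndex (α : ℕ → Ordinal.{0}) (φ : PreForm) : Ordinal.{0} :=
  if φ.SetVarsBelow 1 then α (φ.size + 3) else closureOrd

theorem nuIndex_congr (α : ℕ → Ordinal.{0}) {φ ψ : PreForm}
    (h : φ.SetVarsBelow 1 ↔ ψ.SetVarsBelow 1) (hsize : φ.size = ψ.size) :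
    nuIndex α φ = nuIndex α ψ := by
  by_cases h' : ψ.SetVarsBelow 1 <;> simp [nuIndex, h, hsize, h']

@[simp] theorem nuIndex_subst (α : ℕ → Ordinal.{0}) (φ : PreForm) (σ : ℕ → Term) :
    nuIndex α (φ.subst σ) = nuIndex α φ :=
  nuIndex_congr α (by simp) (by simp)

theorem nuIndex_setRename (α : ℕ → Ordinal.{0}) (φ : PreForm) (f : ℕ → ℕ) :
    nuIndex α (φ.setRename (push 0 fun i => f i + 1)) = nuIndex α φ := by
  refine nuIndex_congr α (PreForm.setVarsBelow_setRename _ _ _ fun i => ?_) (by simp)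
  cases i <;> simp [push]

/-- Satisfaction, where the `ν`-terms `S` without free set variables are replaced by their
approximation at stage `α S.size`. -/
def PreForm.SatStage (α : ℕ → Ordinal.{0}) : PreForm → (ℕ → ℕ) → (ℕ → Set ℕ) → Prop
  | .lt s t, ρ, _ => s.eval ρ < t.eval ρ
  | .nlt s t, ρ, _ => ¬ s.eval ρ < t.eval ρ
  | .eq s t, ρ, _ => s.eval ρ = t.eval ρ
  | .ne s t, ρ, _ => s.eval ρ ≠ t.eval ρ
  | .mem t i, ρ, V => t.eval ρ ∈ V i
  | .nmem t i, ρ, V => t.eval ρ ∉ V i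
  | .and φ ψ, ρ, V => φ.SatStage α ρ V ∧ ψ.SatStage α ρ V
  | .or φ ψ, ρ, V => φ.SatStage α ρ V ∨ ψ.SatStage α ρ V
  | .all φ, ρ, V => ∀ a : ℕ, φ.SatStage α (push a ρ) V
  | .ex φ, ρ, V => ∃ a : ℕ, φ.SatStage α (push a ρ) V
  | .memMu t φ, ρ, V =>
      t.eval ρ ∈ leastFix fun A => {a | φ.SatStage α (push a ρ) (push A V)}
  | .memNu t φ, ρ, V =>
      t.eval ρ ∈ nuStage (fun A => {a | φ.SatStage α (push a ρ) (push A V)}) (nuIndex α φ)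

/-- The set denoted by a set term, where the `ν`-terms are approximated. -/
def SetTerm.stageVal (α : ℕ → Ordinal.{0}) (ρ : ℕ → ℕ) (V : ℕ → Set ℕ) : SetTerm → Set ℕ
  | .var i => V i
  | .mu φ => leastFix fun A => {a | φ.SatStage α (push a ρ) (push A V)}
  | .nu φ => nuStage (fun A => {a | φ.SatStage α (push a ρ) (push A V)}) (nuIndex α φ)

theorem SetTerm.satStage_memOf (S : SetTerm) (t : Term) (α : ℕ → Ordinal.{0}) (ρ : ℕ → ℕ)
    (V : ℕ → Set ℕ) : (S.memOf t).SatStage α ρ V ↔ t.eval ρ ∈ S.stageVal α ρ V := by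
  cases S <;> rfl

namespace PreForm

variable {α β : ℕ → Ordinal.{0}}

theorem satStage_subst (φ : PreForm) (σ : ℕ → Term) (ρ : ℕ → ℕ) (V : ℕ → Set ℕ) :
    (φ.subst σ).SatStage α ρ V ↔ φ.SatStage α (fun i => (σ i).eval ρ) V := by
  induction φ generalizing σ ρ V <;>
    simp_all [subst, SatStage, Term.eval_subst, eval_liftSubst]

theorem satStage_inst (φ : PreForm) (t : Term) (ρ : ℕ → ℕ) (V : ℕ → Set ℕ) :
    (φ.inst t).SatStage α ρ V ↔ φ.SatStage α (push (t.eval ρ) ρ) V := by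
  rw [inst, satStage_subst, push_comp (Term.eval ρ)]
  rfl

theorem satStage_setRename (φ : PreForm) (f : ℕ → ℕ) (ρ : ℕ → ℕ) (V : ℕ → Set ℕ) :
    (φ.setRename f).SatStage α ρ V ↔ φ.SatStage α ρ fun i => V (f i) := by
  have hpush : ∀ (f : ℕ → ℕ) (A : Set ℕ) (V : ℕ → Set ℕ),
      (fun i => push A V (push 0 (fun i => f i + 1) i)) = push A fun i => V (f i) := by
    intro f A V
    rw [push_comp (push A V)]
    rfl
  induction φ generalizing f ρ V <;> simp_all [setRename, SatStage, nuIndex_setRename]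

theorem satStage_congr (φ : PreForm) {ρ ρ' : ℕ → ℕ} (V : ℕ → Set ℕ)
    (h : ∀ y, φ.Occurs y → ρ y = ρ' y) : φ.SatStage α ρ V ↔ φ.SatStage α ρ' V := by
  have hpush : ∀ (φ : PreForm) (ρ ρ' : ℕ → ℕ) (a : ℕ),
      (∀ y, φ.Occurs (y + 1) → ρ y = ρ' y) →
      ∀ y, φ.Occurs y → push a ρ y = push a ρ' y := by
    intro φ ρ ρ' a h y hy
    cases y with
    | zero => rfl
    | succ y => exact h y hy
  induction φ generalizing ρ ρ' V with
  | lt s t | nlt s t | eq s t | ne s t =>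
    simp only [SatStage, s.eval_congr fun y hy => h y (.inl hy),
      t.eval_congr fun y hy => h y (.inr hy)]
  | mem t i | nmem t i => simp only [SatStage, t.eval_congr h]
  | and φ ψ ihφ ihψ | or φ ψ ihφ ihψ =>
    simp only [SatStage, ihφ V fun y hy => h y (.inl hy), ihψ V fun y hy => h y (.inr hy)]
  | all φ ih | ex φ ih => simp only [SatStage, ih V (hpush φ ρ ρ' _ h)]
  | memMu t φ ih | memNu t φ ih =>
    simp only [SatStage, t.eval_congr fun y hy => h y (.inl hy),
      ih _ (hpush φ ρ ρ' _ fun y hy => h y (.inr hy))]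

/-- A `ν`-term reads only the coordinate of its own size, which is below that of any formula
containing it. So coordinates from the size of a body upwards can be reset without affecting the
body. -/
theorem satStage_congr_index (φ : PreForm) (h : ∀ k < φ.size, α k = β k) (ρ : ℕ → ℕ)
    (V : ℕ → Set ℕ) : φ.SatStage α ρ V ↔ φ.SatStage β ρ V := by
  induction φ generalizing ρ V with
  | lt | nlt | eq | ne | mem | nmem => rfl
  | and φ ψ ihφ ihψ | or φ ψ ihφ ihψ =>
    simp only [size] at h
    simp only [SatStage, ihφ fun k hk => h k (by omega), ihψ fun k hk => h k (by omega)]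
  | all φ ih | ex φ ih | memMu t φ ih =>
    simp only [size] at h
    simp only [SatStage, ih fun k hk => h k (by omega)]
  | memNu t φ ih =>
    simp only [size] at h
    simp only [SatStage, ih fun k hk => h k (by omega), nuIndex, h (φ.size + 3) (by omega)]

theorem satStage_mono {φ : PreForm} (hφ : φ.NegFree) {ρ : ℕ → ℕ} {V W : ℕ → Set ℕ}
    (hVW : ∀ i, V i ⊆ W i) (h : φ.SatStage α ρ V) : φ.SatStage α ρ W := by
  have hpush : ∀ {V W : ℕ → Set ℕ} {A B : Set ℕ}, (∀ i, V i ⊆ W i) → A ⊆ B →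
      ∀ i, push A V i ⊆ push B W i := by
    intro V W A B hVW hAB i
    cases i with
    | zero => exact hAB
    | succ i => exact hVW i
  induction φ generalizing ρ V W with
  | lt | nlt | eq | ne => exact h
  | nmem => exact hφ.elim
  | mem t i => exact hVW i h
  | and φ ψ ihφ ihψ => exact ⟨ihφ hφ.1 hVW h.1, ihψ hφ.2 hVW h.2⟩
  | or φ ψ ihφ ihψ => exact h.imp (ihφ hφ.1 hVW) (ihψ hφ.2 hVW)
  | all φ ih => exact fun a => ih hφ hVW (h a)
  | ex φ ih => exact h.imp fun a => ih hφ hVW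
  | memMu t φ ih =>
    exact leastFix_mono (fun A a => ih hφ (hpush hVW subset_rfl)) h
  | memNu t φ ih =>
    refine nuStage_mono (fun A B hAB a => ?_) (fun A a => ?_) _ h
    · exact ih hφ (hpush (fun _ => subset_rfl) hAB)
    · exact ih hφ (hpush hVW subset_rfl)

theorem monotone_satStage {φ : PreForm} (hφ : φ.NegFree) (ρ : ℕ → ℕ) (V : ℕ → Set ℕ) :
    Monotone fun A => {a | φ.SatStage α (push a ρ) (push A V)} := by
  intro A B hAB a
  refine satStage_mono hφ fun i => ?_
  cases i with
  | zero => exact hAB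
  | succ i => exact subset_rfl

theorem sat_iff_satStage {φ : PreForm} (hφ : φ.NegFree) (ρ : ℕ → ℕ) (V : ℕ → Set ℕ) :
    φ.Sat ρ V ↔ φ.SatStage (fun _ => closureOrd) ρ V := by
  induction φ generalizing ρ V with
  | lt | nlt | eq | ne | mem => rfl
  | nmem => exact hφ.elim
  | and φ ψ ihφ ihψ | or φ ψ ihφ ihψ => simp only [Sat, SatStage, ihφ hφ.1, ihψ hφ.2]
  | all φ ih | ex φ ih | memMu t φ ih => simp only [Sat, SatStage, ih hφ]
  | memNu t φ ih =>
    simp only [Sat, SatStage, ih hφ, nuIndex, ite_self]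
    rw [nuStage_closureOrd (monotone_satStage (φ := φ) hφ ρ V)]

/-- Every stage contains the greatest fixed point, and without negative literals enlarging the
`ν`-terms preserves satisfaction. Contrapositively, falsity at any stages is genuine falsity. -/
theorem SatStage.of_closureOrd {φ : PreForm} (hφ : φ.NegFree) {ρ : ℕ → ℕ} {V : ℕ → Set ℕ}
    (h : φ.SatStage (fun _ => closureOrd) ρ V) (α : ℕ → Ordinal.{0}) : φ.SatStage α ρ V := by
  induction φ generalizing ρ V with
  | lt | nlt | eq | ne | mem => exact h
  | nmem => exact hφ.elim
  | and φ ψ ihφ ihψ => exact ⟨ihφ hφ.1 h.1, ihψ hφ.2 h.2⟩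
  | or φ ψ ihφ ihψ => exact h.imp (ihφ hφ.1) (ihψ hφ.2)
  | all φ ih => exact fun a => ih hφ (h a)
  | ex φ ih => exact h.imp fun a => ih hφ
  | memMu t φ ih => exact leastFix_mono (fun A a => ih hφ) h
  | memNu t φ ih =>
    simp only [SatStage, nuIndex, ite_self] at h
    rw [nuStage_closureOrd (monotone_satStage (φ := φ) hφ ρ V)] at h
    exact nuStage_mono (monotone_satStage (φ := φ) hφ ρ V) (fun A a => ih hφ) _
      (greatestFix_subset_nuStage (monotone_satStage (φ := φ) hφ ρ V) _ h)

/-! ### Substitution of set terms and unfolding. -/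

theorem stageVal_numShift (S : SetTerm) (a : ℕ) (ρ : ℕ → ℕ) (V : ℕ → Set ℕ) :
    S.numShift.stageVal α (push a ρ) V = S.stageVal α ρ V := by
  cases S <;> simp [SetTerm.numShift, SetTerm.stageVal, satStage_subst, eval_liftSubst, Term.eval,
    push]

theorem stageVal_setShift (S : SetTerm) (A : Set ℕ) (ρ : ℕ → ℕ) (V : ℕ → Set ℕ) :
    S.setShift.stageVal α ρ (push A V) = S.stageVal α ρ V := by
  have hpush : ∀ B : Set ℕ, (fun i => push B (push A V) (push 0 (fun i => i + 1 + 1) i)) =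
      push B V := by
    intro B
    funext i
    cases i <;> rfl
  cases S with
  | var i => rfl
  | mu φ | nu φ =>
    simp [SetTerm.setShift, SetTerm.stageVal, satStage_setRename, hpush, nuIndex_setRename]

/-- Substitution of set terms of size at least `n` for set variables, when only set terms of size
at most `n` are approximated. -/
theorem satStage_setSubst {n : ℕ} (hα : ∀ k > n, α k = closureOrd) {φ : PreForm}
    (hφ : φ.NegFree) (τ : ℕ → SetTerm) (hτ : ∀ i, (∃ j, τ i = .var j) ∨ n ≤ (τ i).size)
    (ρ : ℕ → ℕ) (V : ℕ → Set ℕ) :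
    (φ.setSubst τ).SatStage α ρ V ↔ φ.SatStage α ρ fun i => (τ i).stageVal α ρ V := by
  have hnum : ∀ τ : ℕ → SetTerm, (∀ i, (∃ j, τ i = .var j) ∨ n ≤ (τ i).size) →
      ∀ i, (∃ j, (τ i).numShift = .var j) ∨ n ≤ (τ i).numShift.size := by
    intro τ hτ i
    rcases hτ i with ⟨j, h⟩ | h
    · exact .inl ⟨j, by rw [h]; rfl⟩
    · exact .inr (by simpa using h)
  have hpush : ∀ τ : ℕ → SetTerm, (∀ i, (∃ j, τ i = .var j) ∨ n ≤ (τ i).size) →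
      ∀ i, 1 ≤ i →
        (∃ j, 1 ≤ j ∧ push (.var 0) (fun i => (τ i).numShift.setShift) i = .var j) ∨
        n ≤ (push (.var 0) (fun i => (τ i).numShift.setShift) i).size := by
    intro τ hτ i hi
    cases i with
    | zero => omega
    | succ i =>
      rcases hτ i with ⟨j, h⟩ | h
      · exact .inl ⟨j + 1, by omega, by simp only [push]; rw [h]; rfl⟩
      · exact .inr (by simpa [push] using h)
  have hpush' : ∀ τ : ℕ → SetTerm, (∀ i, (∃ j, τ i = .var j) ∨ n ≤ (τ i).size) →
      ∀ i, (∃ j, push (.var 0) (fun i => (τ i).numShift.setShift) i = .var j) ∨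
        n ≤ (push (.var 0) (fun i => (τ i).numShift.setShift) i).size := by
    intro τ hτ i
    rcases Nat.eq_zero_or_pos i with rfl | hi
    · exact .inl ⟨0, rfl⟩
    · exact (hpush τ hτ i hi).imp_left fun ⟨j, _, h⟩ => ⟨j, h⟩
  have hval : ∀ (τ : ℕ → SetTerm) (a : ℕ) (A : Set ℕ) (ρ : ℕ → ℕ) (V : ℕ → Set ℕ),
      (fun i => (push (.var 0) (fun i => (τ i).numShift.setShift) i).stageVal α (push a ρ)
        (push A V)) = push A fun i => (τ i).stageVal α ρ V := by
    intro τ a A ρ V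
    rw [push_comp (SetTerm.stageVal α (push a ρ) (push A V))]
    simp only [stageVal_setShift, stageVal_numShift]
    rfl
  induction φ generalizing τ ρ V with
  | lt | nlt | eq | ne => rfl
  | nmem => exact hφ.elim
  | mem t i => exact SetTerm.satStage_memOf _ _ _ _ _
  | and φ ψ ihφ ihψ | or φ ψ ihφ ihψ =>
    simp only [setSubst, SatStage, ihφ hφ.1 τ hτ, ihψ hφ.2 τ hτ]
  | all φ ih | ex φ ih =>
    simp only [setSubst, SatStage, ih hφ _ (hnum τ hτ), stageVal_numShift]
  | memMu t φ ih => simp only [setSubst, SatStage, ih hφ _ (hpush' τ hτ), hval]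
  | memNu t φ ih =>
    -- A closed `ν`-term is untouched by the substitution. An open one has index `closureOrd`, and
    -- keeps it: either it stays open, or it has absorbed a set term of size at least `n`, so that
    -- its own size exceeds `n` and `hα` applies. The bound 1 is there because variable 0 is bound
    -- by the `ν`.
    have hidx : nuIndex α (φ.setSubst (push (.var 0) fun i => (τ i).numShift.setShift)) =
        nuIndex α φ := by
      by_cases h : φ.SetVarsBelow 1
      · rw [setSubst_eq_self φ 1 _ h]
        intro i hi
        obtain rfl : i = 0 := by omega
        rfl
      · simp only [nuIndex, if_neg h]
        split_ifs with h'
        · have := le_size_setSubst φ hφ 1 _ h h' (hpush τ hτ)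
          exact hα _ (by omega)
        · rfl
    simp only [setSubst, SatStage, ih hφ _ (hpush' τ hτ), hval, hidx]

theorem satStage_unfold {S : SetTerm} (hα : ∀ k > S.size, α k = closureOrd) {φ : PreForm}
    (hφ : φ.NegFree) (t : Term) (ρ : ℕ → ℕ) (V : ℕ → Set ℕ) :
    (φ.unfold S t).SatStage α ρ V ↔
      φ.SatStage α (push (t.eval ρ) ρ) (push (S.stageVal α ρ V) V) := by
  rw [unfold, satStage_setSubst hα (hφ.inst t), satStage_inst,
    push_comp (SetTerm.stageVal α ρ V)]
  · rfl
  · intro i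
    cases i with
    | zero => exact .inr le_rfl
    | succ i => exact .inl ⟨i, rfl⟩

/-! ### Negation in the standard model. -/

/-- Literals in the variables of binders already passed are left unchanged, so these variables must
take complementary values on the two sides. Each further binder then turns the operator into its
dual, and complementation of fixed points applies. -/
theorem sat_negAux (φ : PreForm) (b : ℕ) (ρ : ℕ → ℕ) (V W : ℕ → Set ℕ)
    (hlt : ∀ i < b, W i = (V i)ᶜ) (hge : ∀ i, b ≤ i → W i = V i) :
    (φ.negAux b).Sat ρ W ↔ ¬ φ.Sat ρ V := by
  have key : ∀ (b : ℕ) (V W : ℕ → Set ℕ) (A : Set ℕ), (∀ i < b, W i = (V i)ᶜ) →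
      (∀ i, b ≤ i → W i = V i) → (∀ i < b + 1, push A W i = (push Aᶜ V i)ᶜ) ∧
      ∀ i, b + 1 ≤ i → push A W i = push Aᶜ V i := by
    intro b V W A hlt hge
    constructor <;> intro i hi <;> cases i
    · simp [push]
    · exact hlt _ (by omega)
    · omega
    · exact hge _ (by omega)
  induction φ generalizing b ρ V W with
  | lt | nlt | eq | ne => simp [negAux, Sat]
  | mem t i | nmem t i =>
    by_cases h : i < b
    · simp [negAux, Sat, h, hlt i h]
    · simp [negAux, Sat, h, hge i (not_lt.1 h)]
  | and φ ψ ihφ ihψ | or φ ψ ihφ ihψ =>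
    simp only [negAux, Sat, ihφ b ρ V W hlt hge, ihψ b ρ V W hlt hge]
    tauto
  | all φ ih | ex φ ih => simp [negAux, Sat, ih b _ V W hlt hge]
  | memMu t φ ih =>
    have h := greatestFix_compl fun A => {a | φ.Sat (push a ρ) (push A V)}
    rw [Set.ext_iff] at h
    refine Iff.trans ?_ (h (t.eval ρ))
    simp only [negAux, Sat,
      fun A a => ih (b + 1) (push a ρ) _ _ (key b V W A hlt hge).1 (key b V W A hlt hge).2]
    rfl
  | memNu t φ ih =>
    have h := leastFix_compl fun A => {a | φ.Sat (push a ρ) (push A V)}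
    rw [Set.ext_iff] at h
    refine Iff.trans ?_ (h (t.eval ρ))
    simp only [negAux, Sat,
      fun A a => ih (b + 1) (push a ρ) _ _ (key b V W A hlt hge).1 (key b V W A hlt hge).2]
    rfl

theorem sat_neg (φ : PreForm) (ρ : ℕ → ℕ) (V : ℕ → Set ℕ) : φ.neg.Sat ρ V ↔ ¬ φ.Sat ρ V :=
  sat_negAux φ 0 ρ V V (fun _ hi => absurd hi (Nat.not_lt_zero _)) fun _ _ => rfl

end PreForm

/-! ### Signatures -/

/-- The first `n` entries of a family of ordinals, ordered lexicographically. -/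
def trunc (n : ℕ) (α : ℕ → Ordinal.{0}) : Lex (Fin n → Ordinal.{0}) := toLex fun i => α i

theorem trunc_lt {n : ℕ} {α β : ℕ → Ordinal.{0}} :
    trunc n α < trunc n β ↔ ∃ k < n, (∀ j < k, α j = β j) ∧ α k < β k := by
  constructor
  · rintro ⟨i, heq, hlt⟩
    exact ⟨i, i.2, fun j hj => heq ⟨j, hj.trans i.2⟩ hj, hlt⟩
  · rintro ⟨k, hk, heq, hlt⟩
    exact ⟨⟨k, hk⟩, fun j hj => heq j hj, hlt⟩

theorem trunc_eq {n : ℕ} {α β : ℕ → Ordinal.{0}} :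
    trunc n α = trunc n β ↔ ∀ k < n, α k = β k :=
  ⟨fun h k hk => congrFun (congrArg ofLex h) ⟨k, hk⟩,
    fun h => congrArg toLex (funext fun i => h i i.2)⟩

/-- Dropping the least significant coordinates preserves weak inequalities. Minimality of a
signature for length `N` therefore controls all shorter truncations at once. -/
theorem trunc_le_of_le {m n : ℕ} (hmn : m ≤ n) {α β : ℕ → Ordinal.{0}}
    (h : trunc n α ≤ trunc n β) : trunc m α ≤ trunc m β := by
  rcases h.lt_or_eq with h | h
  · obtain ⟨k, -, heq, hlt⟩ := trunc_lt.1 h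
    rcases lt_or_ge k m with hk | hk
    · exact (trunc_lt.2 ⟨k, hk, heq, hlt⟩).le
    · exact (trunc_eq.2 fun j hj => heq j (hj.trans_le hk)).le
  · exact (trunc_eq.2 fun k hk => trunc_eq.1 h k (hk.trans_le hmn)).le

/-- `α` falsifies the pre-formula, and its first `N` entries are lexicographically minimal. -/
def IsSignature (N : ℕ) (V : ℕ → Set ℕ) (φ : PreForm) (ρ : ℕ → ℕ) (α : ℕ → Ordinal.{0}) : Prop :=
  ¬ φ.SatStage α ρ V ∧ ∀ β, ¬ φ.SatStage β ρ V → trunc N α ≤ trunc N β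

/-- Some signature of a falsified pre-formula. -/
noncomputable def signature (N : ℕ) (V : ℕ → Set ℕ) (φ : PreForm) (ρ : ℕ → ℕ) :
    ℕ → Ordinal.{0} :=
  Classical.epsilon (IsSignature N V φ ρ)

theorem isSignature_signature (N : ℕ) {V : ℕ → Set ℕ} {φ : PreForm} {ρ : ℕ → ℕ}
    {α : ℕ → Ordinal.{0}} (h : ¬ φ.SatStage α ρ V) :
    IsSignature N V φ ρ (signature N V φ ρ) := by
  have hne : {α | ¬ φ.SatStage α ρ V}.Nonempty := ⟨α, h⟩
  -- The lexicographic order is well-founded because only finitely many coordinates are compared.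
  have hwf : WellFounded fun β γ : ℕ → Ordinal.{0} => trunc N β < trunc N γ :=
    InvImage.wf (trunc N) wellFounded_lt
  exact Classical.epsilon_spec (p := IsSignature N V φ ρ) ⟨hwf.min _ hne, hwf.min_mem _ hne,
    fun β hβ => not_lt.1 (hwf.not_lt_min _ hβ)⟩

namespace PreForm

/-- Resetting the coordinates above the size of the `μ`-term licenses `satStage_unfold`. The body
does not notice the reset, so what remains is the fixed point equation. -/
theorem not_satStage_unfold_mu {α : ℕ → Ordinal.{0}} {φ : PreForm} (hφ : φ.NegFree) {t : Term}
    {ρ : ℕ → ℕ} {V : ℕ → Set ℕ} (h : ¬ (memMu t φ).SatStage α ρ V) :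
    ∃ β : ℕ → Ordinal.{0}, (∀ k ≤ φ.size + 3, β k = α k) ∧
      ¬ (φ.unfold (.mu φ) t).SatStage β ρ V := by
  refine ⟨fun k => if k ≤ φ.size + 3 then α k else closureOrd, fun k hk => if_pos hk, ?_⟩
  set β : ℕ → Ordinal.{0} := fun k => if k ≤ φ.size + 3 then α k else closureOrd
  rw [satStage_unfold (S := .mu φ) (α := β) (fun k hk => if_neg (not_le.2 hk)) hφ]
  have hβ : ∀ k < φ.size, β k = α k := fun k hk => if_pos (by omega)
  simp only [SetTerm.stageVal, φ.satStage_congr_index hβ]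
  have hfix := (isLeast_leastFix (monotone_satStage (α := α) hφ ρ V)).1
  intro h'
  apply h
  change t.eval ρ ∈ leastFix _
  rw [← show _ = _ from hfix]
  exact h'

/-- Failing a stage means failing the operator applied to some earlier stage γ, and γ becomes the
new coordinate. Closedness guarantees that the stage is really read from `α`. Larger coordinates may
grow, which is harmless lexicographically. -/
theorem not_satStage_unfold_nu {α : ℕ → Ordinal.{0}} {φ : PreForm} (hφ : φ.NegFree)
    (hclosed : φ.SetVarsBelow 1) {t : Term} {ρ : ℕ → ℕ} {V : ℕ → Set ℕ}
    (h : ¬ (memNu t φ).SatStage α ρ V) :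
    ∃ β : ℕ → Ordinal.{0}, (∀ k < φ.size + 3, β k = α k) ∧
      β (φ.size + 3) < α (φ.size + 3) ∧ ¬ (φ.unfold (.nu φ) t).SatStage β ρ V := by
  simp only [SatStage, mem_nuStage, nuIndex, if_pos hclosed, not_forall] at h
  obtain ⟨γ, hγ, h⟩ := h
  refine ⟨fun k => if k < φ.size + 3 then α k else if k = φ.size + 3 then γ else closureOrd,
    fun k hk => if_pos hk, by simpa using hγ, ?_⟩
  set β : ℕ → Ordinal.{0} := fun k =>
    if k < φ.size + 3 then α k else if k = φ.size + 3 then γ else closureOrd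
  rw [satStage_unfold _ hφ]
  · have hβ : ∀ k < φ.size, β k = α k := fun k hk => if_pos (by omega)
    have hβ' : β (φ.size + 3) = γ := by simp [β]
    simp only [SetTerm.stageVal, φ.satStage_congr_index hβ, nuIndex, if_pos hclosed, hβ']
    exact h
  · intro k hk
    have hk' : φ.size + 3 < k := hk
    simp only [β]
    rw [if_neg (by omega), if_neg (by omega)]

end PreForm

/-! ### Local soundness -/

/-- No formula of the sequent is satisfied. -/
abbrev Falsified (V : ℕ → Set ℕ) (Γ : Sequent) (ρ : ℕ → ℕ) : Prop :=
  ∀ φ ∈ Γ, ¬ φ.SatStage (fun _ => closureOrd) ρ V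

/-- Compared with the signature of `φ` under `ρ`, the signature of `ψ` under `ρ'` behaves as it
should for a step of a trace from `φ`, at position `p` of the conclusion of `r`, to `ψ`. -/
def Descends (N : ℕ) (V : ℕ → Set ℕ) (r : Rule) (p : ℕ) (φ : PreForm) (ρ : ℕ → ℕ) (ψ : PreForm)
    (ρ' : ℕ → ℕ) : Prop :=
  ∀ n < N, (∀ S, r.Unfolds p S → n ≤ S.size) →
    trunc (n + 1) (signature N V ψ ρ') ≤ trunc (n + 1) (signature N V φ ρ) ∧
    ((∃ χ, r.Unfolds p (.nu χ) ∧ (SetTerm.nu χ).size = n) →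
      trunc (n + 1) (signature N V ψ ρ') < trunc (n + 1) (signature N V φ ρ))

section

variable {N : ℕ} {V : ℕ → Set ℕ} {r : Rule} {p : ℕ} {φ ψ : PreForm} {ρ ρ' : ℕ → ℕ}

/-- If the signature of `φ` also falsifies `ψ`, minimality bounds the signature of `ψ` by it. -/
theorem descends_of_not_unfolds (hr : ∀ S, ¬ r.Unfolds p S)
    (h : ¬ ψ.SatStage (signature N V φ ρ) ρ' V) : Descends N V r p φ ρ ψ ρ' := fun _ hn _ =>
  ⟨trunc_le_of_le hn ((isSignature_signature N h).2 _ h), fun ⟨_, hχ, _⟩ => (hr _ hχ).elim⟩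

theorem descends_of_imp (hr : ∀ S, ¬ r.Unfolds p S)
    (hφ : ¬ φ.SatStage (fun _ => closureOrd) ρ V)
    (h : ∀ α, ψ.SatStage α ρ' V → φ.SatStage α ρ V) : Descends N V r p φ ρ ψ ρ' :=
  descends_of_not_unfolds hr (mt (h _) (isSignature_signature N hφ).1)

theorem descends_mu {Γ : Sequent} {t : Term} {χ : PreForm} (hχ : χ.NegFree)
    (h : ¬ (PreForm.memMu t χ).SatStage (fun _ => closureOrd) ρ V) :
    Descends N V (.mu Γ t χ) Γ.length (.memMu t χ) ρ (χ.unfold (.mu χ) t) ρ := by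
  intro n hn hle
  obtain ⟨β, hβ, hsat⟩ := PreForm.not_satStage_unfold_mu hχ (isSignature_signature N h).1
  have hn' : n ≤ χ.size + 3 := hle _ ⟨rfl, rfl⟩
  refine ⟨?_, fun ⟨_, hu, _⟩ => nomatch hu.2⟩
  rw [← trunc_eq.2 fun k (hk : k < n + 1) => hβ k (by omega)]
  exact trunc_le_of_le hn ((isSignature_signature N hsat).2 _ hsat)

theorem descends_nu {Γ : Sequent} {t : Term} {χ : PreForm} (hχ : χ.NegFree)
    (hclosed : χ.SetVarsBelow 1)
    (h : ¬ (PreForm.memNu t χ).SatStage (fun _ => closureOrd) ρ V) :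
    Descends N V (.nu Γ t χ) Γ.length (.memNu t χ) ρ (χ.unfold (.nu χ) t) ρ := by
  intro n hn hle
  obtain ⟨β, hβ, hlt, hsat⟩ :=
    PreForm.not_satStage_unfold_nu hχ hclosed (isSignature_signature N h).1
  have hn' : n ≤ χ.size + 3 := hle _ ⟨rfl, rfl⟩
  have hβle : trunc (n + 1) (signature N V (χ.unfold (.nu χ) t) ρ) ≤ trunc (n + 1) β :=
    trunc_le_of_le hn ((isSignature_signature N hsat).2 _ hsat)
  -- The lowered coordinate is the last one kept by the truncation precisely when `n` is the size of
  -- the unfolded term.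
  have hstrict : n = χ.size + 3 →
      trunc (n + 1) β < trunc (n + 1) (signature N V (.memNu t χ) ρ) := by
    rintro rfl
    exact trunc_lt.2 ⟨_, Nat.lt_succ_self _, fun j hj => hβ j hj, hlt⟩
  refine ⟨hβle.trans ?_, ?_⟩
  · rcases hn'.lt_or_eq with h' | h'
    · exact (trunc_eq.2 fun k hk => hβ k (by omega)).le
    · exact (hstrict h').le
  · rintro ⟨χ', ⟨-, hu⟩, hsize⟩
    cases hu
    exact hβle.trans_lt (hstrict hsize.symm)

theorem getElem?_append_length (Γ : Sequent) (φ : PreForm) (Δ : Sequent) :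
    (Γ ++ φ :: Δ)[Γ.length]? = some φ := by
  simp

theorem falsified_append_singleton {Γ : Sequent}
    (h : Falsified V Γ ρ) (hχ : ¬ ψ.SatStage (fun _ => closureOrd) ρ V) :
    Falsified V (Γ ++ [ψ]) ρ := by
  intro φ hφ
  rcases List.mem_append.1 hφ with hφ | hφ
  · exact h φ hφ
  · rwa [List.mem_singleton.1 hφ]

/-- Traces through a premise that consists of the side formulas `Γ` and one active formula. -/
theorem descends_of_side_or_principal {Γ : Sequent} {χ χ' : PreForm} {q : ℕ}
    (hΓ : Falsified V Γ ρ) (hr : ∀ p < Γ.length, ∀ S, ¬ r.Unfolds p S)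
    (hside : ∀ φ ∈ Γ, ∀ α, φ.SatStage α ρ' V → φ.SatStage α ρ V)
    (hprincipal : Descends N V r Γ.length χ ρ χ' ρ')
    (hpq : (p < Γ.length ∧ q = p) ∨ (p = Γ.length ∧ q = Γ.length))
    (hp : (Γ ++ [χ])[p]? = some φ) (hq : (Γ ++ [χ'])[q]? = some ψ) :
    Descends N V r p φ ρ ψ ρ' := by
  rcases hpq with ⟨hlt, rfl⟩ | ⟨rfl, rfl⟩
  · rw [List.getElem?_append_left hlt] at hp hq
    obtain rfl : φ = ψ := Option.some_injective _ (hp.symm.trans hq)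
    have hmem := List.mem_of_getElem? hp
    exact descends_of_imp (hr _ hlt) (hΓ _ hmem) (hside _ hmem)
  · rw [getElem?_append_length] at hp hq
    cases hp
    cases hq
    exact hprincipal

end

theorem sat_natSet (t : Term) (ρ : ℕ → ℕ) (V : ℕ → Set ℕ) : (natSet.memOf t).Sat ρ V := by
  simp only [natSet, SetTerm.memOf, PreForm.Sat]
  refine Set.mem_sInter.2 fun A hA => ?_
  generalize t.eval ρ = n
  induction n with
  | zero => exact hA (.inl rfl)
  | succ n ih => exact hA (.inr ⟨n, ih, rfl⟩)

theorem sat_paAxiom (x y : ℕ) (i : Fin 7) (ρ : ℕ → ℕ) (V : ℕ → Set ℕ) :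
    (paAxiom x y i).Sat ρ V := by
  fin_cases i <;>
    simp [paAxiom, PreForm.imp, PreForm.iff, PreForm.sat_neg, PreForm.Sat, Term.eval, push]
  · tauto
  · ring
  · ring
  · constructor
    · rcases lt_or_ge (ρ x) (ρ y) with h | h
      · exact .inr ⟨ρ y - ρ x - 1, by omega⟩
      · exact .inl h
    · rcases lt_or_ge (ρ x) (ρ y) with h | h
      · exact .inr h
      · exact .inl fun a => by omega

/-- If the conclusion of a rule is falsified, then so is one of its premises, in such a way that
signatures descend along all traces. -/
theorem Rule.exists_falsified_premise (N : ℕ) (V : ℕ → Set ℕ) (r : Rule)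
    (hconclusion : IsSequent r.conclusion) (hpremises : ∀ Γ ∈ r.premises, IsSequent Γ)
    (hcondition : r.SideCondition) (ρ : ℕ → ℕ) (hfalse : Falsified V r.conclusion ρ) :
    ∃ (b : Bool) (Δ : Sequent) (ρ' : ℕ → ℕ), r.premises[b.toNat]? = some Δ ∧
      Falsified V Δ ρ' ∧ ∀ p q φ ψ, r.Ancestor p q → r.conclusion[p]? = some φ →
        Δ[q]? = some ψ → Descends N V r p φ ρ ψ ρ' := by
  have hsat : ∀ φ ∈ r.conclusion, ¬ φ.Sat ρ V := fun φ hφ =>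
    mt (PreForm.sat_iff_satStage (hconclusion.negFree hφ) ρ V).1 (hfalse φ hφ)
  have hstage : ∀ {Δ : Sequent} {ψ : PreForm} {α : ℕ → Ordinal.{0}} {ρ' : ℕ → ℕ},
      Δ ∈ r.premises → ψ ∈ Δ → ¬ ψ.SatStage α ρ' V →
      ¬ ψ.SatStage (fun _ => closureOrd) ρ' V := fun hΔ hψ h =>
    mt (fun h' => h'.of_closureOrd ((hpremises _ hΔ).negFree hψ) _) h
  cases r with
  | id Γ φ =>
    have h := hsat φ.neg (by simp [conclusion])
    rw [PreForm.sat_neg] at h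
    exact absurd (hsat φ (by simp [conclusion])) h
  | refl t => exact absurd rfl (hsat (.eq t t) (by simp [conclusion]))
  | pa i x y => exact absurd (sat_paAxiom x y i ρ V) (hsat _ (by simp [conclusion]))
  | nat t => exact absurd (sat_natSet t ρ V) (hsat _ (by simp [conclusion]))
  | weak Γ Δ =>
    have hΓ : Falsified V Γ ρ := fun φ hφ => hfalse φ (List.mem_append_left _ hφ)
    refine ⟨false, Γ, ρ, rfl, hΓ, ?_⟩
    rintro p q φ ψ ⟨hlt, rfl⟩ hp hq
    rw [conclusion, List.getElem?_append_left hlt] at hp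
    obtain rfl : φ = ψ := Option.some_injective _ (hp.symm.trans hq)
    exact descends_of_imp (fun _ h => h) (hΓ _ (List.mem_of_getElem? hp)) fun _ => _root_.id
  | exch Γ χ χ' Δ =>
    refine ⟨false, Γ ++ χ' :: χ :: Δ, ρ, rfl, fun φ hφ => hfalse φ ?_, ?_⟩
    · simp only [conclusion, List.mem_append, List.mem_cons] at hφ ⊢
      tauto
    · intro p q φ ψ hpq hp hq
      simp only [conclusion] at hp
      obtain rfl : φ = ψ := by
        refine Option.some_injective _ (hp.symm.trans (Eq.trans ?_ hq))
        rcases hpq with ⟨hlt, rfl⟩ | ⟨rfl, rfl⟩ | ⟨rfl, rfl⟩ | ⟨hge, -, rfl⟩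
        · rw [List.getElem?_append_left hlt, List.getElem?_append_left hlt]
        · simp
        · simp
        · obtain ⟨k, rfl⟩ := Nat.exists_eq_add_of_le hge
          rw [List.getElem?_append_right (by omega), List.getElem?_append_right (by omega),
            show Γ.length + 2 + k - Γ.length = k + 2 by omega]
          rfl
      exact descends_of_imp (fun _ h => h) (hfalse _ (List.mem_of_getElem? hp)) fun _ => _root_.id
  | sub θ Γ =>
    have hΓ : Falsified V Γ fun i => (θ i).eval ρ := fun φ hφ =>
      mt (φ.satStage_subst θ ρ V).2 (hfalse _ (List.mem_map_of_mem hφ))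
    refine ⟨false, Γ, _, rfl, hΓ, ?_⟩
    rintro p q φ ψ ⟨hlt, rfl⟩ hp hq
    simp only [conclusion, List.getElem?_map, hq, Option.map_some, Option.some.injEq] at hp
    subst hp
    exact descends_of_imp (fun _ h => h)
      (hfalse _ (List.mem_map_of_mem (List.mem_of_getElem? hq)))
      fun _ => (ψ.satStage_subst θ ρ V).2
  | cut Γ χ =>
    -- No trace passes through the cut formula, so its truth value alone may select the premise.
    have hcut : ∃ (b : Bool) (χ' : PreForm),
        (Rule.cut Γ χ).premises[b.toNat]? = some (Γ ++ [χ']) ∧ ¬ χ'.Sat ρ V := by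
      by_cases h : χ.Sat ρ V
      · exact ⟨true, χ.neg, rfl, by rwa [PreForm.sat_neg, not_not]⟩
      · exact ⟨false, χ, rfl, h⟩
    obtain ⟨b, χ', hb, hχ'⟩ := hcut
    have hneg : χ'.NegFree := (hpremises _ (List.mem_of_getElem? hb)).negFree (by simp)
    refine ⟨b, _, ρ, hb, falsified_append_singleton hfalse
      (mt (PreForm.sat_iff_satStage hneg ρ V).2 hχ'), ?_⟩
    rintro p q φ ψ ⟨hlt, rfl⟩ hp hq
    rw [List.getElem?_append_left hlt] at hq
    obtain rfl : φ = ψ := Option.some_injective _ (hp.symm.trans hq)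
    exact descends_of_imp (fun _ h => h) (hfalse _ (List.mem_of_getElem? hp)) fun _ => _root_.id
  | and Γ χ₀ χ₁ =>
    have hΓ : Falsified V Γ ρ := fun φ hφ => hfalse φ (List.mem_append_left _ hφ)
    -- The premise is selected by the signature of the conjunction: a conjunct that is merely false
    -- might have a larger signature.
    have hsig := (isSignature_signature N (hfalse (.and χ₀ χ₁) (by simp [conclusion]))).1
    have hand : ∃ (b : Bool) (χ' : PreForm),
        (Rule.and Γ χ₀ χ₁).premises[b.toNat]? = some (Γ ++ [χ']) ∧
        ¬ χ'.SatStage (signature N V (.and χ₀ χ₁) ρ) ρ V := by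
      rcases not_and_or.1 hsig with h | h
      · exact ⟨false, χ₀, rfl, h⟩
      · exact ⟨true, χ₁, rfl, h⟩
    obtain ⟨b, χ', hb, hχ'⟩ := hand
    refine ⟨b, _, ρ, hb, falsified_append_singleton hΓ
      (hstage (List.mem_of_getElem? hb) (by simp) hχ'), fun p q φ ψ hpq hp hq => ?_⟩
    exact descends_of_side_or_principal hΓ (fun _ _ _ h => h) (fun _ _ _ => _root_.id)
      (descends_of_not_unfolds (fun _ h => h) hχ') hpq hp hq
  | or Γ χ₀ χ₁ =>
    have hΓ : Falsified V Γ ρ := fun φ hφ => hfalse φ (List.mem_append_left _ hφ)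
    have hor := hfalse (.or χ₀ χ₁) (by simp [conclusion])
    refine ⟨false, Γ ++ [χ₀, χ₁], ρ, rfl, ?_, fun p q φ ψ hpq hp hq => ?_⟩
    · intro φ hφ
      simp only [List.mem_append, List.mem_cons, List.not_mem_nil, or_false] at hφ
      rcases hφ with hφ | rfl | rfl
      · exact hΓ φ hφ
      · exact fun h => hor (.inl h)
      · exact fun h => hor (.inr h)
    · rcases hpq with ⟨hlt, rfl⟩ | ⟨rfl, rfl | rfl⟩
      · rw [conclusion, List.getElem?_append_left hlt] at hp
        rw [List.getElem?_append_left hlt] at hq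
        obtain rfl : φ = ψ := Option.some_injective _ (hp.symm.trans hq)
        exact descends_of_imp (fun _ h => h) (hΓ _ (List.mem_of_getElem? hp)) fun _ => _root_.id
      · simp only [conclusion, getElem?_append_length, Option.some.injEq] at hp hq
        subst hp hq
        exact descends_of_imp (fun _ h => h) hor fun _ => .inl
      · simp only [conclusion, getElem?_append_length, Option.some.injEq] at hp
        obtain rfl : χ₁ = ψ := by simpa using hq
        subst hp
        exact descends_of_imp (fun _ h => h) hor fun _ => .inr
  | all Γ χ y =>
    have hΓ : Falsified V Γ ρ := fun φ hφ => hfalse φ (List.mem_append_left _ hφ)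
    have hsig := (isSignature_signature N (hfalse (.all χ) (by simp [conclusion]))).1
    -- The counterexample likewise comes from the signature, and becomes the value of the fresh
    -- variable.
    obtain ⟨a, ha⟩ := not_forall.1 hsig
    have hfresh : ∀ φ ∈ Γ, ∀ α, φ.SatStage α (Function.update ρ y a) V ↔ φ.SatStage α ρ V := by
      intro φ hφ α
      refine φ.satStage_congr V fun z hz => Function.update_of_ne ?_ _ _
      rintro rfl
      exact hcondition φ (List.mem_append_left _ hφ) hz
    have hact : ¬ (χ.inst (.var y)).SatStage (signature N V (.all χ) ρ)
        (Function.update ρ y a) V := by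
      rw [PreForm.satStage_inst]
      refine mt (χ.satStage_congr V fun z hz => ?_).1 ha
      cases z with
      | zero => simp [push, Term.eval]
      | succ z =>
        refine Function.update_of_ne ?_ _ _
        rintro rfl
        exact hcondition (.all χ) (by simp) hz
    refine ⟨false, _, Function.update ρ y a, rfl, falsified_append_singleton
      (fun φ hφ => mt (hfresh φ hφ _).1 (hΓ φ hφ))
      (hstage (List.mem_singleton.2 rfl) (by simp) hact), fun p q φ ψ hpq hp hq => ?_⟩
    exact descends_of_side_or_principal hΓ (fun _ _ _ h => h) (fun φ hφ α => (hfresh φ hφ α).1)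
      (descends_of_not_unfolds (fun _ h => h) hact) hpq hp hq
  | ex Γ χ t =>
    have hΓ : Falsified V Γ ρ := fun φ hφ => hfalse φ (List.mem_append_left _ hφ)
    have hex := hfalse (.ex χ) (by simp [conclusion])
    have himp : ∀ α, (χ.inst t).SatStage α ρ V → (PreForm.ex χ).SatStage α ρ V := fun α h =>
      ⟨_, (χ.satStage_inst t ρ V).1 h⟩
    refine ⟨false, _, ρ, rfl, falsified_append_singleton hΓ (mt (himp _) hex),
      fun p q φ ψ hpq hp hq => ?_⟩
    exact descends_of_side_or_principal hΓ (fun _ _ _ h => h) (fun _ _ _ => _root_.id)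
      (descends_of_imp (fun _ h => h) hex himp) hpq hp hq
  | eqSub Γ s t =>
    have heq : s.eval ρ = t.eval ρ := not_not.1 (hsat (.ne s t) (by simp [conclusion]))
    have himp : ∀ (φ : PreForm) (α : ℕ → Ordinal.{0}),
        (φ.inst s).SatStage α ρ V → (φ.inst t).SatStage α ρ V := by
      intro φ α
      rw [PreForm.satStage_inst, PreForm.satStage_inst, heq]
      exact _root_.id
    refine ⟨false, Γ.map (PreForm.inst s), ρ, rfl, ?_, ?_⟩
    · intro φ hφ
      obtain ⟨χ, hχ, rfl⟩ := List.mem_map.1 hφ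
      exact mt (himp χ _) (hfalse _ (List.mem_append_left _ (List.mem_map_of_mem hχ)))
    · rintro p q φ ψ ⟨hlt, rfl⟩ hp hq
      rw [conclusion, List.getElem?_append_left (by simpa using hlt), List.getElem?_map] at hp
      rw [List.getElem?_map] at hq
      obtain ⟨χ, hχ, rfl⟩ := Option.map_eq_some_iff.1 hp
      simp only [hχ, Option.map_some, Option.some.injEq] at hq
      subst hq
      exact descends_of_imp (fun _ h => h) (hfalse _ (List.mem_append_left _
        (List.mem_map_of_mem (List.mem_of_getElem? hχ)))) (himp χ)
  | mu Γ t χ =>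
    have hΓ : Falsified V Γ ρ := fun φ hφ => hfalse φ (List.mem_append_left _ hφ)
    have hmem : PreForm.memMu t χ ∈ (Rule.mu Γ t χ).conclusion := by simp [conclusion]
    have hneg : χ.NegFree := (hconclusion.negFree hmem :)
    obtain ⟨β, -, hβ⟩ := PreForm.not_satStage_unfold_mu hneg (hfalse _ hmem)
    refine ⟨false, _, ρ, rfl, falsified_append_singleton hΓ
      (hstage (List.mem_singleton.2 rfl) (by simp) hβ), fun p q φ ψ hpq hp hq => ?_⟩
    exact descends_of_side_or_principal hΓ (fun _ hlt _ h => hlt.ne h.1) (fun _ _ _ => _root_.id)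
      (descends_mu hneg (hfalse _ hmem)) hpq hp hq
  | nu Γ t χ =>
    have hΓ : Falsified V Γ ρ := fun φ hφ => hfalse φ (List.mem_append_left _ hφ)
    have hmem : PreForm.memNu t χ ∈ (Rule.nu Γ t χ).conclusion := by simp [conclusion]
    have hneg : χ.NegFree := (hconclusion.negFree hmem :)
    have hclosed : χ.SetVarsBelow 1 := (hconclusion _ hmem).2
    obtain ⟨β, -, -, hβ⟩ := PreForm.not_satStage_unfold_nu hneg hclosed (hfalse _ hmem)
    refine ⟨false, _, ρ, rfl, falsified_append_singleton hΓ
      (hstage (List.mem_singleton.2 rfl) (by simp) hβ), fun p q φ ψ hpq hp hq => ?_⟩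
    exact descends_of_side_or_principal hΓ (fun _ hlt _ h => hlt.ne h.1) (fun _ _ _ => _root_.id)
      (descends_nu hneg hclosed (hfalse _ hmem)) hpq hp hq

/-! ### Cyclic coderivations and the infinite descent. -/

theorem Rule.Ancestor.lt_length {r : Rule} {p q : ℕ} (h : r.Ancestor p q) :
    p < r.conclusion.length := by
  cases r <;> simp only [Rule.Ancestor, Rule.conclusion, List.length_append, List.length_cons,
    List.length_nil, List.length_map] at h ⊢ <;> omega

/-- The set term unfolded by a rule is determined by the rule. -/
theorem Rule.Unfolds.unique {r : Rule} {p q : ℕ} {S T : SetTerm} (hS : r.Unfolds p S)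
    (hT : r.Unfolds q T) : S = T := by
  cases r with
  | mu | nu => exact hS.2.trans hT.2.symm
  | _ => exact hS.elim

namespace Coderivation

/-- The rule instances that occur in the coderivation. -/
def rules (D : Coderivation) : Set Rule := {r | ∃ u, D.label u = some r}

/-- Each rule instance is the root label of the sub-coderivation at its node. -/
theorem IsCyclic.finite_rules {D : Coderivation} (h : D.IsCyclic) : D.rules.Finite := by
  refine Set.Finite.of_finite_image ((h.image fun f => f []).subset ?_)
    (Set.injOn_of_injective (Option.some_injective _))
  rintro _ ⟨r, ⟨u, hu⟩, rfl⟩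
  exact ⟨_, ⟨u, by simp [hu], rfl⟩, by simpa using hu⟩

theorem IsCyclic.exists_size_lt {D : Coderivation} (h : D.IsCyclic) :
    ∃ N, ∀ r ∈ D.rules, ∀ p S, r.Unfolds p S → S.size < N := by
  have hr : ∀ r : Rule, ∃ m, ∀ p S, r.Unfolds p S → S.size < m := by
    intro r
    by_cases h : ∃ p S, r.Unfolds p S
    · obtain ⟨p, S, hS⟩ := h
      exact ⟨S.size + 1, fun q T hT => by rw [hT.unique hS]; exact Nat.lt_succ_self _⟩
    · exact ⟨0, fun p S hS => absurd ⟨p, S, hS⟩ h⟩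
  choose m hm using hr
  obtain ⟨N, hN⟩ := (h.finite_rules.image m).bddAbove
  exact ⟨N, fun r hr p S hS => (hm r p S hS).trans_le (hN ⟨r, hr, rfl⟩)⟩

/-- With finitely many rule instances, infinitely many unfoldings of smaller terms would use one
instance infinitely often. An instance unfolds only one set term, so that term would progress
infinitely often. -/
theorem IsCyclic.eventually_le_size {D : Coderivation} (h : D.IsCyclic) {v : ℕ → List Bool}
    {p : ℕ → ℕ} {n : ℕ} (hn : ∀ S, D.ProgressesInfinitelyOften v p S → n ≤ S.size) :
    ∃ m, ∀ i ≥ m, ∀ r, D.label (v i) = some r → ∀ S, r.Unfolds (p i) S → n ≤ S.size := by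
  have hall : ∀ᶠ i in Filter.atTop, ∀ r ∈ D.rules,
      D.label (v i) = some r → ∀ S, r.Unfolds (p i) S → n ≤ S.size := by
    rw [Filter.eventually_all_finite h.finite_rules]
    intro r _
    by_contra hcon
    rw [Filter.not_eventually] at hcon
    obtain ⟨i, hi⟩ := hcon.exists
    push Not at hi
    obtain ⟨-, S, hS, hlt⟩ := hi
    refine absurd (hn S fun m => ?_) (not_le.2 hlt)
    obtain ⟨j, hj, hj'⟩ := Filter.frequently_atTop.1 hcon m
    push Not at hj'
    obtain ⟨hlabel, T, hT, -⟩ := hj'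
    exact ⟨j, hj, r, hlabel, hS.unique hT ▸ hT⟩
  obtain ⟨m, hm⟩ := Filter.eventually_atTop.1 hall
  exact ⟨m, fun i hi r hr => hm i hi r ⟨_, hr⟩ hr⟩

/-- A falsified conclusion yields an infinite branch of falsified sequents, with assignments for
which signatures descend along all traces. -/
theorem exists_falsified_branch (D : Coderivation) (N : ℕ) (V : ℕ → Set ℕ) {r₀ : Rule}
    (hr₀ : D.label [] = some r₀) {ρ₀ : ℕ → ℕ} (hfalse : Falsified V r₀.conclusion ρ₀) :
    ∃ (v : ℕ → List Bool) (ρ : ℕ → ℕ → ℕ) (r : ℕ → Rule), D.IsBranch v ∧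
      (∀ i, D.label (v i) = some (r i)) ∧
      ∀ i p q φ ψ, (r i).Ancestor p q → (r i).conclusion[p]? = some φ →
        (r (i + 1)).conclusion[q]? = some ψ → Descends N V (r i) p φ (ρ i) ψ (ρ (i + 1)) := by
  let State := {x : List Bool × (ℕ → ℕ) × Rule //
    D.label x.1 = some x.2.2 ∧ Falsified V x.2.2.conclusion x.2.1}
  have hstep : ∀ x : State, ∃ y : State, (∃ b, y.1.1 = x.1.1 ++ [b]) ∧
      ∀ p q φ ψ, x.1.2.2.Ancestor p q → x.1.2.2.conclusion[p]? = some φ →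
        y.1.2.2.conclusion[q]? = some ψ → Descends N V x.1.2.2 p φ x.1.2.1 ψ y.1.2.1 := by
    rintro ⟨⟨u, ρ, r⟩, hlabel, hf⟩
    obtain ⟨hc, hp, hs⟩ := D.sequents u r hlabel
    obtain ⟨b, Δ, ρ', hb, hΔ, hdesc⟩ := r.exists_falsified_premise N V hc hp hs ρ hf
    have hsucc := D.successors u r hlabel b
    rw [hb] at hsucc
    obtain ⟨r', hr', rfl⟩ := Option.map_eq_some_iff.1 hsucc
    exact ⟨⟨⟨u ++ [b], ρ', r'⟩, hr', hΔ⟩, ⟨b, rfl⟩, hdesc⟩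
  -- Dependent choice on triples of node, assignment and rule; the descent holds for all traces at
  -- once.
  choose next hnext hdesc using hstep
  let x : ℕ → State := fun i => next^[i] ⟨⟨[], ρ₀, r₀⟩, hr₀, hfalse⟩
  have hx : ∀ i, x (i + 1) = next (x i) := fun i => Function.iterate_succ_apply' _ _ _
  refine ⟨fun i => (x i).1.1, fun i => (x i).1.2.1, fun i => (x i).1.2.2, ⟨rfl, ?_, ?_⟩,
    fun i => (x i).2.1, ?_⟩
  · intro i
    beta_reduce
    rw [hx]
    exact hnext _
  · intro i
    rw [(x i).2.1]
    exact Option.some_ne_none _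
  · intro i
    beta_reduce
    rw [hx]
    exact hdesc _

theorem not_falsified (D : Coderivation) (hcyclic : D.IsCyclic) (hprogressing : D.IsProgressing)
    {r₀ : Rule} (hr₀ : D.label [] = some r₀) (ρ₀ : ℕ → ℕ) (V : ℕ → Set ℕ) :
    ¬ Falsified V r₀.conclusion ρ₀ := by
  intro hfalse
  obtain ⟨N, hN⟩ := hcyclic.exists_size_lt
  obtain ⟨v, ρ, r, hbranch, hlabel, hdesc⟩ := D.exists_falsified_branch N V hr₀ hfalse
  obtain ⟨k, p, htrace, χ, hχ, hmin⟩ := hprogressing v hbranch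
  obtain ⟨m, hm⟩ := hcyclic.eventually_le_size hmin
  have hanc : ∀ i ≥ k, (r i).Ancestor (p i) (p (i + 1)) := by
    intro i hi
    obtain ⟨r', hr', h⟩ := htrace i hi
    cases (hlabel i).symm.trans hr'
    exact h
  have hform : ∀ i, ∃ φ, i ≥ k → (r i).conclusion[p i]? = some φ := by
    intro i
    by_cases hi : i ≥ k
    · exact ⟨_, fun _ => List.getElem?_eq_getElem (hanc i hi).lt_length⟩
    -- Before index `k` the trace is undefined, and an arbitrary formula serves as filler.
    · exact ⟨.eq .zero .zero, fun h => absurd h hi⟩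
  choose φ hφ using hform
  set n := (SetTerm.nu χ).size
  have hnN : n < N := by
    obtain ⟨i, -, r', hr', hu⟩ := hχ 0
    exact hN r' ⟨_, hr'⟩ _ _ hu
  set s : ℕ → Lex (Fin (n + 1) → Ordinal.{0}) := fun i =>
    trunc (n + 1) (signature N V (φ i) (ρ i))
  have hs : ∀ i ≥ max k m, s (i + 1) ≤ s i ∧
      ((∃ χ, (r i).Unfolds (p i) (.nu χ) ∧ (SetTerm.nu χ).size = n) → s (i + 1) < s i) := by
    intro i hi
    have hik : i ≥ k := le_of_max_le_left hi
    exact hdesc i _ _ _ _ (hanc i hik) (hφ i hik) (hφ (i + 1) (by omega)) n hnN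
      (hm i (le_of_max_le_right hi) _ (hlabel i))
  -- Take the least truncated signature past both thresholds. The `ν`-term is unfolded again at some
  -- later `j`, after which the value falls below this minimum.
  obtain ⟨_, ⟨i, (hi : max k m ≤ i), rfl⟩, hleast⟩ := wellFounded_lt.has_min (s '' Set.Ici (max k m))
    ⟨_, _, Set.self_mem_Ici, rfl⟩
  obtain ⟨j, hj, r', hr', hu⟩ := hχ i
  cases (hlabel j).symm.trans hr'
  have hle : s j ≤ s i :=
    Nat.le_induction le_rfl (fun l hl ih => (hs l (hi.trans hl)).1.trans ih) j hj
  refine hleast (s (j + 1)) ⟨j + 1, ?_, rfl⟩ (((hs j (hi.trans hj)).2 ⟨χ, hu, rfl⟩).trans_le hle)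
  exact hi.trans (by omega)

end Coderivation

end MuPA

theorem mainTheorem5 (D : MuPA.Coderivation) (hcyclic : D.IsCyclic) (hprogressing : D.IsProgressing)
    (Γ : MuPA.Sequent) (hΓ : D.HasConclusion Γ) : MuPA.TrueInStandardModel Γ := by
  intro ρ V
  obtain ⟨r, hr, rfl⟩ := Option.map_eq_some_iff.1 hΓ
  by_contra h
  refine D.not_falsified hcyclic hprogressing hr ρ V fun φ hφ hsat => h ⟨φ, hφ, ?_⟩
  exact (MuPA.PreForm.sat_iff_satStage ((D.sequents _ _ hr).1.negFree hφ) ρ V).2 hsat
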